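/- Let $L$ be a first-order language and $T$ a complete $L$-theory, and write $|T|=|L|+\aleph_0$. Suppose that $T$ is unstable (i.e. some formula $\varphi(x,y)$, with $x,y$ finite tuples of variables, has the order property: in some model of $T$ there are tuples $(b_i)_{i<\omega}$, $(c_j)_{j<\omega}$ such that $\varphi(b_i,c_j)$ holds if and only if $i<j$), and that $T$ is not supersimple (i.e. there are a subset $A$ of a model of $T$ and a complete type $p\in S_n(A)$, $n<\omega$, which forks over every finite subset of $A$). Let $\kappa$ be a singular cardinal with $\mathrm{cf}(\kappa)=\omega$ and $\kappa\ge|T|$. Then there are a language $L_1\supseteq L$ and a complete (in particular consistent) $L_1$-theory $T_1\supseteq T$ with $|T_1|=|T|$ such that for every model $M\models T_1$: if the reduct $M\restriction L$ is $\kappa$-saturated, then $M\restriction L$ is $\kappa^{+}$-saturated. (Here a structure is $\kappa$-saturated if it realizes every complete type in finitely many variables over each set of fewer than $\kappa$ of its elements.) -/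

import Mathlib

universe u v w

namespace FirstOrder.Language

open Cardinal FirstOrder

section Types

variable {L : Language.{u, v}} {M : Type w} [L.Structure M]

/-- `p ∈ S_n(A)`: `p` is a complete `n`-type over the parameter set `A ⊆ M`, computed in the
structure `M`. A formula `φ(x, a)` with parameters from `A` is an `L`-formula whose variables are
`Fin n` (the tuple `x`) together with `A`, each element of `A` being a name for itself.
Consistency with the complete theory of `M` with names for `A` is finite satisfiability in `M`. -/
def IsCompleteTypeOver (A : Set M) {n : ℕ} (p : Set (L.Formula (Fin n ⊕ A))) : Prop :=
  (∀ p₀ : Finset (L.Formula (Fin n ⊕ A)), (p₀ : Set (L.Formula (Fin n ⊕ A))) ⊆ p →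
    ∃ x : Fin n → M, ∀ φ ∈ p₀, φ.Realize (Sum.elim x (fun a : A => (a : M)))) ∧
  ∀ φ : L.Formula (Fin n ⊕ A), φ ∈ p ∨ φ.not ∈ p

variable (L) in
/-- `M` is `κ`-saturated: every complete type in finitely many variables over a set of fewer than
`κ` parameters from `M` is realized in `M`. -/
def IsSaturated (κ : Cardinal.{w}) (M : Type w) [L.Structure M] : Prop :=
  ∀ A : Set M, #A < κ → ∀ (n : ℕ) (p : Set (L.Formula (Fin n ⊕ A))), IsCompleteTypeOver A p →
    ∃ x : Fin n → M, ∀ φ ∈ p, φ.Realize (Sum.elim x (fun a : A => (a : M)))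

/-- The formula `ψ(x, c)`, with `c` a finite tuple from `M`, divides over `B ⊆ M`: in some
elementary extension `N` of `M` there are a sequence `(s i)_{i < ω}` of realizations of `tp(c/B)`
and a `k < ω` such that `{ψ(x, s i) : i < ω}` is `k`-inconsistent. -/
def Divides {n m : ℕ} (ψ : L.Formula (Fin n ⊕ Fin m)) (c : Fin m → M) (B : Set M) : Prop :=
  ∃ (N : Type w) (_ : L.Structure N) (f : M ↪ₑ[L] N) (s : ℕ → Fin m → N) (k : ℕ),
    (∀ (i : ℕ) (θ : L.Formula (Fin m ⊕ B)),
      θ.Realize (Sum.elim (s i) (fun b : B => f b)) ↔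
        θ.Realize (Sum.elim c (fun b : B => (b : M)))) ∧
    ∀ I : Finset ℕ, I.card = k → ¬ ∃ x : Fin n → N, ∀ i ∈ I, ψ.Realize (Sum.elim x (s i))

/-- The type `p` over `A ⊆ M` forks over `B ⊆ M`: it implies, i.e. finitely many of its formulas
imply, a finite disjunction `⋁ i, ψ i (x, c i)` of formulas that divide over `B`, where the
parameters `c i` come from some elementary extension `N` of `M`. -/
def Forks {A : Set M} {n : ℕ} (p : Set (L.Formula (Fin n ⊕ A))) (B : Set M) : Prop :=
  ∃ (N : Type w) (_ : L.Structure N) (f : M ↪ₑ[L] N)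
    (p₀ : Finset (L.Formula (Fin n ⊕ A))) (r : ℕ) (m : Fin r → ℕ)
    (ψ : ∀ i, L.Formula (Fin n ⊕ Fin (m i))) (c : ∀ i, Fin (m i) → N),
    (p₀ : Set (L.Formula (Fin n ⊕ A))) ⊆ p ∧
    (∀ i, Divides (ψ i) (c i) (f '' B)) ∧
    ∀ x : Fin n → N, (∀ φ ∈ p₀, φ.Realize (Sum.elim x (fun a : A => f a))) →
      ∃ i, (ψ i).Realize (Sum.elim x (c i))

end Types

namespace Theory

variable {L : Language.{u, v}}

/-- The cardinality `|T|` of an `L`-theory, with the usual convention that it is the number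
`|L| + ℵ₀` of `L`-formulas. -/
noncomputable def size (_T : L.Theory) : Cardinal.{max u v} :=
  max ℵ₀ L.card

/-- `T` is stable: no formula `φ(x, y)`, with `x` and `y` finite tuples of variables, has the order
property in a model of `T`. -/
def IsStable (T : L.Theory) : Prop :=
  ¬ ∃ (M : T.ModelType.{u, v, max u v}) (n m : ℕ) (φ : L.Formula (Fin n ⊕ Fin m))
      (b : ℕ → Fin n → M) (c : ℕ → Fin m → M),
      ∀ i j : ℕ, φ.Realize (Sum.elim (b i) (c j)) ↔ i < j

/-- `T` is supersimple: every complete type in finitely many variables over a set `A` of parameters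
does not fork over some finite subset of `A`. -/
def IsSupersimple (T : L.Theory) : Prop :=
  ∀ (M : T.ModelType.{u, v, max u v}) (A : Set M) (n : ℕ) (p : Set (L.Formula (Fin n ⊕ A))),
    IsCompleteTypeOver A p → ∃ A₀ ⊆ A, A₀.Finite ∧ ¬ Forks p A₀

end Theory

end FirstOrder.Language

-- The theory `T₁` equips each of its models with a nonstandard copy of arithmetic and with
-- functions that decode ω-sequences of elements from finite tuples. Saturation then passes from κ
-- to κ⁺ by overspill. Let `p` be a type over `A` with |A| ≤ κ. As cf(κ) = ω, `A` is an increasing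
-- union of sets `S i` of size below κ, and the part of `p` over `S i` has a realization `d i`.
-- Decoding the sequence `d` from tuples makes sense of `d` at nonstandard indices as well. Each
-- formula of `p` holds at `d i` for all large standard `i`, hence, by the least number principle,
-- up to some nonstandard bound. There are at most κ formulas, so a nonstandard number below all the
-- bounds is an index at which `d` realizes `p`.
--
-- Instability supplies that number. With the order property indexed by the numbers, κ-saturation
-- realizes the cut just above the standard numbers and below fewer than κ given nonstandard ones,
-- and the least number past this cut is nonstandard (`exists_lower_bound_of_lt`). Countable
-- cofinality extends this to κ many (`exists_lower_bound_of_le`).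
--
-- The failure of supersimplicity supplies the decoding (`exists_dec_eq`). A type forking over all
-- finite sets produces trees of instances whose siblings are `k`-inconsistent and whose branches
-- are consistent (`exists_hasTree_of_forks`), and by compactness a tree whose labels are the
-- elements of the model itself. Saturation realizes the branch labelled by a given sequence by a
-- tuple `x`. Given `x` and the earlier terms, fewer than `k` labels are possible for the next term,
-- so the sequence is recovered from `x` and a function from ω to ω. That function is read off from
-- an order-property cut among rational positions of finite sequences (`treePos`).
--
-- Finally `T₁` is the complete theory of an ultraproduct of standard expansions of one coding model
-- in which a constant `inf` names larger and larger numbers. By Łoś's theorem the first-order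
-- coding axioms survive and `inf` becomes nonstandard.

universe u' v'

namespace FirstOrder.Language

open Cardinal FirstOrder

/-! ### Trees of instances from forking -/

section Trees

variable {L : Language.{u, v}}

/-- The data attached to one level of a tree of instances: a formula `ψ(x, y)` in a fixed number
`n` of object variables, together with a degree of inconsistency `k`. -/
structure LevelData (L : Language.{u, v}) (n : ℕ) where
  /-- The number of parameter variables. -/
  arity : ℕ
  /-- The formula of the level. -/
  formula : L.Formula (Fin n ⊕ Fin arity)
  /-- The degree of inconsistency of siblings. -/
  k : ℕ

/-- Put one level in front of a sequence of levels. -/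
def LevelData.cons {n : ℕ} (l : LevelData L n) (σ : ℕ → LevelData L n) : ℕ → LevelData L n
  | 0 => l
  | i + 1 => σ i

/-- There is a tree of height `t` and width `d` of instances of the level formulas in `N`, whose
siblings are `k`-inconsistent and whose branches are consistent with `P`. -/
def HasTree {n : ℕ} (N : Type w) [L.Structure N] (d : ℕ) :
    ℕ → (ℕ → LevelData L n) → ((Fin n → N) → Prop) → Prop
  | 0, _, P => ∃ x, P x
  | t + 1, σ, P => ∃ s : Fin d → Fin (σ 0).arity → N,
      (∀ I : Finset (Fin d), I.card = (σ 0).k →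
        ¬ ∃ x : Fin n → N, ∀ i ∈ I, (σ 0).formula.Realize (Sum.elim x (s i))) ∧
      ∀ i, HasTree N d t (fun j => σ (j + 1))
        (fun x => P x ∧ (σ 0).formula.Realize (Sum.elim x (s i)))

namespace HasTree

variable {n : ℕ} {N : Type w} [L.Structure N] {d t : ℕ} {σ : ℕ → LevelData L n}
  {P Q : (Fin n → N) → Prop}

theorem mono (h : HasTree N d t σ P) (hPQ : ∀ x, P x → Q x) : HasTree N d t σ Q := by
  induction t generalizing σ P Q with
  | zero => exact h.imp hPQ
  | succ t ih =>
    obtain ⟨s, hs, hi⟩ := h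
    exact ⟨s, hs, fun i => ih (hi i) fun x hx => ⟨hPQ x hx.1, hx.2⟩⟩

theorem congr_levels {σ' : ℕ → LevelData L n} (h : HasTree N d t σ P)
    (hσ : ∀ i < t, σ i = σ' i) : HasTree N d t σ' P := by
  induction t generalizing σ σ' P with
  | zero => exact h
  | succ t ih =>
    have h0 := hσ 0 (Nat.succ_pos t)
    simp only [HasTree] at h ⊢
    rw [← h0]
    obtain ⟨s, hs, hi⟩ := h
    exact ⟨s, hs, fun i => ih (hi i) fun j hj => hσ (j + 1) (by omega)⟩

theorem of_injective {d' : ℕ} (f : Fin d' → Fin d) (hf : Function.Injective f)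
    (h : HasTree N d t σ P) : HasTree N d' t σ P := by
  induction t generalizing σ P with
  | zero => exact h
  | succ t ih =>
    obtain ⟨s, hs, hi⟩ := h
    refine ⟨fun i => s (f i), fun I hI => ?_, fun i => ih (hi (f i))⟩
    rintro ⟨x, hx⟩
    refine hs (I.map ⟨f, hf⟩) (by simpa using hI) ⟨x, ?_⟩
    simpa using hx

theorem mono_width {d' : ℕ} (hd : d' ≤ d) (h : HasTree N d t σ P) : HasTree N d' t σ P :=
  h.of_injective (Fin.castLE hd) (Fin.castLE_injective hd)

/-- Positive width is essential: with no children, a tree of positive height says nothing about `P`.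
For this reason widths are written `d + 1` below. -/
theorem exists_sat (h : HasTree N (d + 1) t σ P) : ∃ x, P x := by
  induction t generalizing σ P with
  | zero => exact h
  | succ t ih =>
    obtain ⟨s, hs, hi⟩ := h
    exact (ih (hi 0)).imp fun x hx => hx.1

theorem mono_height {t' : ℕ} (ht : t' ≤ t) (h : HasTree N (d + 1) t σ P) :
    HasTree N (d + 1) t' σ P := by
  induction t generalizing t' σ P with
  | zero => obtain rfl : t' = 0 := by omega
            exact h
  | succ t ih =>
    cases t' with
    | zero => exact h.exists_sat
    | succ t' =>
      obtain ⟨s, hs, hi⟩ := h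
      exact ⟨s, hs, fun i => ih (by omega) (hi i)⟩

/-- If the branches of a wide tree are covered by finitely many properties, then the branches of
a narrower tree all satisfy one of them. -/
theorem exists_color {r : ℕ} {Q : Fin r → (Fin n → N) → Prop}
    (h : HasTree N (r * d + 1) t σ P) (hQ : ∀ x, P x → ∃ i, Q i x) :
    ∃ i, HasTree N (d + 1) t σ (fun x => P x ∧ Q i x) := by
  induction t generalizing σ P with
  | zero =>
    obtain ⟨x, hx⟩ := h
    obtain ⟨i, hi⟩ := hQ x hx
    exact ⟨i, x, hx, hi⟩
  | succ t ih =>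
    obtain ⟨s, hs, hi⟩ := h
    choose c hc using fun i => ih (hi i) (fun x hx => hQ x hx.1)
    -- More than `r * d` children share `r` colours, so some colour occurs at least `d + 1` times.
    obtain ⟨j, hj⟩ := Fintype.exists_lt_card_fiber_of_mul_lt_card (n := d) c (by simp)
    obtain ⟨J, hJ, hJc⟩ := Finset.exists_subset_card_eq (Nat.succ_le_of_lt hj)
    let f : Fin (d + 1) ↪o Fin (r * d + 1) := J.orderEmbOfFin hJc
    have hf : ∀ i, c (f i) = j := fun i => by
      have := hJ (J.orderEmbOfFin_mem hJc i)
      simpa using this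
    refine ⟨j, fun i => s (f i), fun I hI => ?_, fun i => ?_⟩
    · rintro ⟨x, hx⟩
      exact hs (I.map f.toEmbedding) (by simpa using hI) ⟨x, by simpa using hx⟩
    · have := hc (f i)
      rw [hf] at this
      exact this.mono fun x hx => ⟨⟨hx.1.1, hx.2⟩, hx.1.2⟩

/-- If every colour failed at some width, a tree wide enough for the largest of these finitely many
widths would contradict `exists_color`. Thus one colour serves all widths. -/
theorem exists_color_forall {r : ℕ} {Q : Fin r → (Fin n → N) → Prop}
    (h : ∀ d, HasTree N (d + 1) t σ P) (hQ : ∀ x, P x → ∃ i, Q i x) :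
    ∃ i, ∀ d, HasTree N (d + 1) t σ (fun x => P x ∧ Q i x) := by
  by_contra! hcon
  choose e he using hcon
  obtain ⟨i, hi⟩ := exists_color (d := Finset.univ.sup e) (h _) hQ
  exact he i (hi.mono_width (Nat.succ_le_succ (Finset.le_sup (Finset.mem_univ i))))

end HasTree

/-- Having a tree consistent with a formula is a first-order property of its parameters. -/
theorem exists_formula_hasTree {n : ℕ} (d t : ℕ) (σ : ℕ → LevelData L n) {γ : Type w}
    (θ : L.Formula (Fin n ⊕ γ)) :
    ∃ τ : L.Formula γ, ∀ (N : Type (max u v)) [L.Structure N] (y : γ → N),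
      τ.Realize y ↔ HasTree N d t σ (fun x => θ.Realize (Sum.elim x y)) := by
  induction t generalizing σ γ with
  | zero =>
    refine ⟨(θ.relabel (Sum.elim Sum.inr Sum.inl)).iExs (Fin n), fun N _ y => ?_⟩
    simp only [Formula.realize_iExs, Formula.realize_relabel, HasTree, Sum.comp_elim,
      Sum.elim_comp_inl, Sum.elim_comp_inr]
  | succ t ih =>
    let γ' := γ ⊕ (Fin d × Fin (σ 0).arity)
    choose τ hτ using fun i : Fin d => ih (fun j => σ (j + 1)) (γ := γ')
      (θ.relabel (Sum.map id Sum.inl) ⊓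
        (σ 0).formula.relabel (Sum.map id fun j => Sum.inr (i, j)))
    let ρ : Finset (Fin d) → L.Formula γ' := fun I =>
      ((Formula.iInf fun i : I =>
        (σ 0).formula.relabel
          (Sum.elim Sum.inr fun j => Sum.inl (Sum.inr (i.1, j)))).iExs (Fin n)).not
    refine ⟨((Formula.iInf fun I : {I : Finset (Fin d) // I.card = (σ 0).k} => ρ I.1) ⊓
      Formula.iInf τ).iExs (Fin d × Fin (σ 0).arity), fun N _ y => ?_⟩
    simp only [Formula.realize_iExs, Formula.realize_inf, Formula.realize_iInf, hτ, HasTree, ρ,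
      Formula.realize_not, Formula.realize_relabel, Sum.comp_elim, Sum.elim_comp_map,
      Sum.elim_comp_inr, Subtype.forall, Function.comp_id]
    exact (Equiv.curry (Fin d) (Fin (σ 0).arity) N).exists_congr_left.trans (by rfl)

/-- A formula uses only finitely many of its parameters. -/
theorem Formula.exists_restrict_params {α β : Type*} (φ : L.Formula (α ⊕ β)) :
    ∃ B : Set β, B.Finite ∧ ∃ φ' : L.Formula (α ⊕ B), ∀ (N : Type w) [L.Structure N]
      (x : α → N) (y : β → N),
      φ'.Realize (Sum.elim x fun b : B => y b) ↔ φ.Realize (Sum.elim x y) := by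
  classical
  let B : Set β := {b | Sum.inr b ∈ φ.freeVarFinset}
  refine ⟨B, φ.freeVarFinset.finite_toSet.preimage Sum.inr_injective.injOn,
    φ.restrictFreeVar fun a => match a with
      | ⟨Sum.inl a, _⟩ => Sum.inl a
      | ⟨Sum.inr b, h⟩ => Sum.inr ⟨b, h⟩, fun N _ x y => ?_⟩
  refine BoundedFormula.realize_restrictFreeVar (φ := φ) _ ?_
  rintro ⟨a | b, h⟩ <;> rfl

variable {M : Type (max u v)} [L.Structure M]

/-- If `p` forks over all finite sets, then every finite part `Q` of `p` extends to a finite part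
`Q'`, such that trees consistent with `Q'` can be prolonged at the root to trees consistent with
`Q` by one of finitely many levels. -/
theorem exists_levels_of_forks {A : Set M} {n : ℕ} {p : Set (L.Formula (Fin n ⊕ A))}
    (hp : ∀ B ⊆ A, B.Finite → Forks p B) (Q : Finset (L.Formula (Fin n ⊕ A))) :
    ∃ (Q' : Finset (L.Formula (Fin n ⊕ A))) (Δ : Finset (LevelData L n)),
      ((Q : Set (L.Formula (Fin n ⊕ A))) ⊆ p → (Q' : Set (L.Formula (Fin n ⊕ A))) ⊆ p) ∧
      ∀ t σ, (∀ d, HasTree M (d + 1) t σ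
          fun x => ∀ φ ∈ Q', φ.Realize (Sum.elim x (fun a : A => (a : M)))) →
        ∃ l ∈ Δ, ∀ d, HasTree M (d + 1) (t + 1) (LevelData.cons l σ)
          fun x => ∀ φ ∈ Q, φ.Realize (Sum.elim x (fun a : A => (a : M))) := by
  classical
  -- `B` is the finite set of parameters of `Q`; the forking of `p` is applied over exactly this
  -- set.
  obtain ⟨B, hBfin, θ, hθ⟩ :=
    (Formula.iInf fun φ : Q => φ.1).exists_restrict_params (α := Fin n) (β := A)
  obtain ⟨N, _, f, p₀, r, m, ψ, c, hp₀, hdiv, hcov⟩ :=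
    hp (Subtype.val '' B) (by rintro _ ⟨a, _, rfl⟩; exact a.2) (hBfin.image _)
  choose N' S' g s k hs hk using hdiv
  let l : Fin r → LevelData L n := fun i => ⟨m i, ψ i, k i⟩
  have hθQ : ∀ (K : Type (max u v)) [L.Structure K] (x : Fin n → K) (y : A → K),
      θ.Realize (Sum.elim x fun b : B => y b) ↔ ∀ φ ∈ Q, φ.Realize (Sum.elim x y) := by
    intro K _ x y
    rw [hθ]
    simp
  refine ⟨Q ∪ p₀, Finset.univ.image l, fun hQ => by simpa using ⟨hQ, hp₀⟩, fun t σ h => ?_⟩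
  have hN : ∀ d, HasTree N (d + 1) t σ
      fun x => ∀ φ ∈ Q ∪ p₀, φ.Realize (Sum.elim x (fun a : A => f a)) := by
    intro d
    obtain ⟨τ, hτ⟩ := exists_formula_hasTree (d + 1) t σ
      (Formula.iInf fun φ : (Q ∪ p₀ : Finset _) => φ.1)
    have h1 := hτ M (fun a : A => (a : M))
    have h2 := hτ N (fun a : A => f a)
    have h3 := f.map_formula τ (fun a : A => (a : M))
    simp only [Formula.realize_iInf, Subtype.forall] at h1 h2
    exact h2.1 (h3.2 (h1.2 (h d)))
  -- The disjuncts of the forking formula are the colours: one dividing instance is consistent with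
  -- trees of all widths.
  obtain ⟨i, hi⟩ := HasTree.exists_color_forall (r := r)
    (Q := fun i x => (ψ i).Realize (Sum.elim x (c i))) hN
    (fun x hx => hcov x fun φ hφ => hx φ (Finset.mem_union_right _ hφ))
  refine ⟨l i, by simp, fun d => ?_⟩
  let _ := S' i
  -- The dividing sequence becomes the new bottom level. Its terms have the type of `c i` over the
  -- parameters of `Q`, so the tree found above `c i` exists above each of them.
  have hN' : HasTree (N' i) (d + 1) (t + 1) (LevelData.cons (l i) σ)
      fun x => θ.Realize (Sum.elim x fun b : B => g i (f b)) := by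
    obtain ⟨τ, hτ⟩ := exists_formula_hasTree (d + 1) t σ (γ := B ⊕ Fin (m i))
      (θ.relabel (Sum.map id Sum.inl) ⊓ (ψ i).relabel (Sum.map id Sum.inr))
    simp only [Formula.realize_inf, Formula.realize_relabel, Sum.elim_comp_map] at hτ
    refine ⟨fun j => s i j, fun I hI => ?_, fun j => ?_⟩
    · rintro ⟨x, hx⟩
      refine hk i (I.map Fin.valEmbedding) ((Finset.card_map _).trans hI) ⟨x, ?_⟩
      rintro _ hj
      obtain ⟨j, hjI, rfl⟩ := Finset.mem_map.1 hj
      exact hx j hjI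
    · have h1 := hτ (N' i) (Sum.elim (fun b : B => g i (f b)) (s i j))
      have h2 := hτ N (Sum.elim (fun b : B => f b) (c i))
      have h3 := hs i j (τ.relabel (Sum.elim
        (fun b : B => Sum.inr ⟨f b, b, ⟨b, b.2, rfl⟩, rfl⟩) Sum.inl))
      simp only [Formula.realize_relabel, Sum.comp_elim, Sum.elim_comp_inl] at h3
      refine h1.1 (h3.2 (h2.2 ?_))
      refine (hi d).mono fun x hx => ⟨?_, hx.2⟩
      exact (hθQ N x fun a => f a).2 fun φ hφ => hx.1 φ (Finset.mem_union_left _ hφ)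
  obtain ⟨τ, hτ⟩ := exists_formula_hasTree (d + 1) (t + 1) (LevelData.cons (l i) σ) θ
  have h1 := (hτ (N' i) _).2 hN'
  have h2 := (g i).map_formula τ (fun b : B => f b)
  have h3 := f.map_formula τ (fun b : B => (b : M))
  exact ((hτ M _).1 (h3.1 (h2.1 h1))).mono fun x hx => (hθQ M x fun a => a).1 hx

/-- A type that forks over all finite sets yields trees of infinite height. -/
theorem exists_hasTree_of_forks {A : Set M} {n : ℕ} {p : Set (L.Formula (Fin n ⊕ A))}
    (hpc : IsCompleteTypeOver A p) (hp : ∀ B ⊆ A, B.Finite → Forks p B) :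
    ∃ σ : ℕ → LevelData L n, ∀ d t, HasTree M (d + 1) t σ fun _ => True := by
  choose Q' Δ hQ' hΔ using exists_levels_of_forks hp
  let Q : ℕ → Finset (L.Formula (Fin n ⊕ A)) := fun i => Q'^[i] ∅
  have hQs : ∀ i, Q (i + 1) = Q' (Q i) := fun i => Function.iterate_succ_apply' _ _ _
  have hQp : ∀ i, (Q i : Set (L.Formula (Fin n ⊕ A))) ⊆ p := by
    intro i
    induction i with
    | zero => simp [Q]
    | succ i ih => rw [hQs]; exact hQ' _ ih
  have key : ∀ t j, ∃ σ : ℕ → LevelData L n, (∀ i < t, σ i ∈ Δ (Q (j + i))) ∧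
      ∀ d, HasTree M (d + 1) t σ
        fun x => ∀ φ ∈ Q j, φ.Realize (Sum.elim x (fun a : A => (a : M))) := by
    intro t
    induction t with
    | zero =>
      exact fun j => ⟨fun _ => ⟨0, ⊥, 0⟩, by simp, fun d => hpc.1 _ (hQp j)⟩
    | succ t ih =>
      intro j
      obtain ⟨σ, hσ, h⟩ := ih (j + 1)
      rw [hQs] at h
      obtain ⟨l, hl, hl'⟩ := hΔ _ t σ h
      refine ⟨LevelData.cons l σ, fun i hi => ?_, hl'⟩
      cases i with
      | zero => exact hl
      | succ i =>
        have := hσ i (by omega)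
        rwa [add_assoc, add_comm 1 i] at this
  choose s hs hst using fun t => key t 0
  -- The levels chosen for height `t` depend on `t`, but at depth `i` they range over a finite set;
  -- an ultrafilter limit selects one sequence of levels for all heights.
  have hlim : ∀ i, ∃ l, ∀ᶠ t in (Filter.hyperfilter ℕ : Filter ℕ), s t i = l := by
    intro i
    have h1 : ∀ᶠ t in (Filter.hyperfilter ℕ : Filter ℕ), ∃ l ∈ Δ (Q (0 + i)), s t i = l := by
      refine Nat.hyperfilter_le_atTop ?_
      filter_upwards [Filter.eventually_gt_atTop i] with t ht
      exact ⟨_, hs t i ht, rfl⟩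
    obtain ⟨l, -, hl⟩ := (Ultrafilter.eventually_exists_mem_iff (Δ (Q (0 + i))).finite_toSet).1 h1
    exact ⟨l, hl⟩
  choose σ hσ using hlim
  refine ⟨σ, fun d t => ?_⟩
  have h1 : ∀ᶠ T in (Filter.hyperfilter ℕ : Filter ℕ), ∀ i ∈ Finset.range t, s T i = σ i :=
    (Filter.eventually_all_finset _).2 fun i _ => hσ i
  have h2 : ∀ᶠ T in (Filter.hyperfilter ℕ : Filter ℕ), t ≤ T :=
    Nat.hyperfilter_le_atTop (Filter.eventually_ge_atTop t)
  obtain ⟨T, hT, hT'⟩ := (h1.and h2).exists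
  exact (((hst T d).mono_height hT').congr_levels fun i hi => hT i (Finset.mem_range.2 hi)).mono
    fun _ _ => trivial

end Trees

/-! ### A model whose tree is labelled by its own elements -/

section CodingModel

variable {L : Language.{u, v}} {n : ℕ}

/-- `F` is a tree of parameters of infinite height, whose nodes are finite sequences of labels:
siblings give `k`-inconsistent instances of the level formulas, and finite branches give
consistent ones. -/
structure IsInstanceTree {N : Type*} [L.Structure N] {Λ : Type*} (σ : ℕ → LevelData L n)
    (F : List Λ → ℕ → N) : Prop where
  inconsistent : ∀ (η : List Λ) (J : Finset Λ), J.card = (σ η.length).k →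
    ¬ ∃ x : Fin n → N, ∀ a ∈ J,
      (σ η.length).formula.Realize (Sum.elim x fun j => F (η ++ [a]) j)
  consistent : ∀ η : List Λ, ∃ x : Fin n → N, ∀ i : Fin η.length,
    (σ i).formula.Realize (Sum.elim x fun j => F (η.take (i + 1)) j)

/-- `φ` orders the sequences `b` and `c` indexed by a linear order. -/
def OrdersBy {N : Type*} [L.Structure N] {ι : Type*} [LT ι] {nb nc : ℕ}
    (φ : L.Formula (Fin nb ⊕ Fin nc)) (b : ι → Fin nb → N) (c : ι → Fin nc → N) : Prop :=
  ∀ q r, φ.Realize (Sum.elim (b q) (c r)) ↔ q < r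

/-- The formula stating that finitely many formulas have a common solution. -/
noncomputable def jointlyConsistent {κ : Type*} [Finite κ] {m : κ → ℕ}
    (ψ : ∀ k, L.Formula (Fin n ⊕ Fin (m k))) : L.Formula (κ × ℕ) :=
  (Formula.iInf fun k => (ψ k).relabel
    (Sum.elim Sum.inr fun j : Fin (m k) => Sum.inl (k, (j : ℕ)))).iExs (Fin n)

theorem realize_jointlyConsistent {κ : Type*} [Finite κ] {m : κ → ℕ}
    (ψ : ∀ k, L.Formula (Fin n ⊕ Fin (m k))) {N : Type*} [L.Structure N] (y : κ × ℕ → N) :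
    (jointlyConsistent ψ).Realize y ↔
      ∃ x : Fin n → N, ∀ k, (ψ k).Realize (Sum.elim x fun j => y (k, j)) := by
  simp only [jointlyConsistent, Formula.realize_iExs, Formula.realize_iInf,
    Formula.realize_relabel, Sum.comp_elim, Sum.elim_comp_inr]
  rfl

/-- Replaces the recursive choice of siblings by one family indexed by finite sequences. Parameter
tuples are padded to sequences indexed by `ℕ`, so that levels of different arity share one type. -/
theorem HasTree.exists_nodes {N : Type w} [L.Structure N] [Nonempty N] {d t : ℕ}
    {σ : ℕ → LevelData L n} {P : (Fin n → N) → Prop} (h : HasTree N d t σ P) :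
    ∃ F : List (Fin d) → ℕ → N,
      (∀ η : List (Fin d), η.length < t → ∀ J : Finset (Fin d), J.card = (σ η.length).k →
        ¬ ∃ x : Fin n → N, ∀ a ∈ J,
          (σ η.length).formula.Realize (Sum.elim x fun j => F (η ++ [a]) j)) ∧
      ∀ η : List (Fin d), η.length = t → ∃ x, P x ∧ ∀ i < t,
        (σ i).formula.Realize (Sum.elim x fun j => F (η.take (i + 1)) j) := by
  induction t generalizing σ P with
  | zero =>
    obtain ⟨x, hx⟩ := h
    exact ⟨fun _ _ => Classical.arbitrary N, by simp, fun _ _ => ⟨x, hx, by simp⟩⟩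
  | succ t ih =>
    obtain ⟨s, hs, hi⟩ := h
    choose F hF hF' using fun i => ih (hi i)
    let G : List (Fin d) → ℕ → N := fun η j => match η with
      | [] => Classical.arbitrary N
      | [i] => if hj : j < (σ 0).arity then s i ⟨j, hj⟩ else Classical.arbitrary N
      | i :: i' :: η => F i (i' :: η) j
    have hG1 : ∀ i, (fun j : Fin (σ 0).arity => G [i] j) = s i := by
      intro i; funext j; simp [G]
    have hG2 : ∀ i η, η ≠ [] → G (i :: η) = F i η := by
      rintro i (_ | ⟨i', η⟩) h
      · exact absurd rfl h
      · rfl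
    refine ⟨G, ?_, ?_⟩
    · rintro (_ | ⟨i, η⟩) hη J hJ ⟨x, hx⟩
      · refine hs J hJ ⟨x, fun a ha => ?_⟩
        rw [← hG1]
        exact hx a ha
      · refine hF i η (by simpa using hη) J (by simpa using hJ) ⟨x, fun a ha => ?_⟩
        have := hx a ha
        rw [List.cons_append, hG2 _ _ (by simp)] at this
        exact this
    · rintro (_ | ⟨a, η⟩) hη
      · simp at hη
      · obtain ⟨x, hx, hx'⟩ := hF' a η (by simpa using hη)
        refine ⟨x, hx.1, fun i hit => ?_⟩
        cases i with
        | zero =>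
          rw [List.take_succ_cons, List.take_zero, hG1]
          exact hx.2
        | succ i =>
          rw [List.take_succ_cons, hG2]
          · exact hx' i (by omega)
          · have : η ≠ [] := by
              rintro rfl
              simp at hη
              omega
            simpa using this

/-- In an ultrapower, trees of finite height and width become a tree of infinite height and
arbitrary width, and the order property becomes available along the rationals. -/
theorem exists_ultrapower_tree_order {M : Type (max u v)} [L.Structure M] [Nonempty M]
    {σ : ℕ → LevelData L n} (hσ : ∀ d t, HasTree M (d + 1) t σ fun _ => True)
    {nb nc : ℕ} {φ : L.Formula (Fin nb ⊕ Fin nc)} {b : ℕ → Fin nb → M} {c : ℕ → Fin nc → M}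
    (hφ : OrdersBy φ b c) (Λ : Type (max u v)) :
    ∃ (N : Type (max u v)) (_ : L.Structure N) (_ : Nonempty N), L.completeTheory M =
      L.completeTheory N ∧ (∃ F : List Λ → ℕ → N, IsInstanceTree σ F) ∧
      ∃ (b : ℚ → Fin nb → N) (c : ℚ → Fin nc → N), OrdersBy φ b c := by
  classical
  -- An index prescribes the height, the labels and the rationals that have to be handled correctly.
  let I := ℕ × Finset Λ × Finset ℚ
  let U : Ultrafilter I := Ultrafilter.of Filter.atTop
  have hU : (U : Filter I) ≤ Filter.atTop := Ultrafilter.of_le _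
  let N := (U : Filter I).Product (fun _ => M)
  have hnodes : ∀ (t : ℕ) (X : Finset Λ), ∃ F : List Λ → ℕ → M,
      (∀ η : List Λ, η.length < t → ∀ J ⊆ X, J.card = (σ η.length).k →
        ¬ ∃ x : Fin n → M, ∀ a ∈ J,
          (σ η.length).formula.Realize (Sum.elim x fun j => F (η ++ [a]) j)) ∧
      ∀ η : List Λ, η.length ≤ t → ∃ x : Fin n → M, ∀ i < η.length,
        (σ i).formula.Realize (Sum.elim x fun j => F (η.take (i + 1)) j) := by
    intro t X
    obtain ⟨F, hF, hF'⟩ := (hσ X.card t).exists_nodes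
    -- Labels outside `X` are all sent to the spare last child; injectivity is needed on `X` only.
    let f : Λ → Fin (X.card + 1) := fun a =>
      if h : a ∈ X then (X.equivFin ⟨a, h⟩).castSucc else Fin.last _
    have hf : Set.InjOn f X := by
      intro a ha a' ha' h
      have ha : a ∈ X := ha
      have ha' : a' ∈ X := ha'
      simpa [f, ha, ha'] using h
    refine ⟨fun η => F (η.map f), fun η hη J hJX hJ => ?_, fun η hη => ?_⟩
    · rintro ⟨x, hx⟩
      refine hF (η.map f) (by simpa using hη) (J.image f) ?_ ⟨x, fun a ha => ?_⟩
      · rw [Finset.card_image_of_injOn (hf.mono (by exact_mod_cast hJX)), hJ, List.length_map]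
      · obtain ⟨a, haJ, rfl⟩ := Finset.mem_image.1 ha
        have := hx a haJ
        simp only [List.map_append, List.map_cons, List.map_nil] at this
        rw [List.length_map]
        exact this
    · obtain ⟨x, -, hx⟩ := hF' (η.map f ++ List.replicate (t - η.length) 0)
        (by simp; omega)
      refine ⟨x, fun i hi => ?_⟩
      have := hx i (by omega)
      rwa [List.take_append_of_le_length (by simpa using hi), ← List.map_take] at this
  choose F hF hF' using hnodes
  have hge : ∀ a₀ : I, ∀ᶠ a in (U : Filter I), a₀ ≤ a :=
    fun a₀ => hU (Filter.eventually_ge_atTop a₀)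
  -- A rational is represented in the ω-sequence by its rank in a finite set; only the left-hand
  -- point has to belong to the set.
  have hrank : ∀ (S : Finset ℚ) (q r : ℚ), q ∈ S →
      ((S.filter (· < q)).card < (S.filter (· < r)).card ↔ q < r) := by
    intro S q r hq
    constructor
    · intro h
      by_contra! hqr
      refine absurd h (not_lt.2 (Finset.card_le_card fun s hs => ?_))
      simp only [Finset.mem_filter] at hs ⊢
      exact ⟨hs.1, hs.2.trans_le hqr⟩
    · intro h
      refine Finset.card_lt_card ((Finset.ssubset_iff_of_subset fun s hs => ?_).2 ⟨q, ?_, ?_⟩)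
      · simp only [Finset.mem_filter] at hs ⊢
        exact ⟨hs.1, hs.2.trans h⟩
      · simpa using ⟨hq, h⟩
      · simp
  let mk : (I → M) → N := fun f => (f : (U : Filter I).Product fun _ => M)
  have los : ∀ {β : Type (max u v)} (ψ : L.Formula β) (x : β → I → M),
      (ψ.Realize fun j => mk (x j)) ↔ ∀ᶠ a in (U : Filter I), ψ.Realize fun j => x j a :=
    fun ψ x => Ultraproduct.realize_formula_cast ψ x
  have losφ : ∀ (x : Fin nb → I → M) (y : Fin nc → I → M),
      φ.Realize (Sum.elim (fun j => mk (x j)) fun j => mk (y j)) ↔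
        ∀ᶠ a in (U : Filter I), φ.Realize (Sum.elim (fun j => x j a) fun j => y j a) := by
    intro x y
    have e : Sum.elim (fun j => mk (x j)) (fun j => mk (y j)) = fun i => mk (Sum.elim x y i) :=
      funext fun i => by cases i <;> rfl
    rw [e]
    refine (Ultraproduct.realize_formula_cast (u := U) (M := fun _ => M) φ (Sum.elim x y)).trans ?_
    exact Filter.eventually_congr (Filter.Eventually.of_forall fun a =>
      iff_of_eq (congrArg _ (funext fun i => by cases i <;> rfl)))
  refine ⟨N, inferInstance, inferInstance, ?_, ⟨fun η j => mk fun a => F a.1 a.2.1 η j, ?_, ?_⟩,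
    fun q j => mk fun a => b (a.2.2.filter (· < q)).card j,
    fun q j => mk fun a => c (a.2.2.filter (· < q)).card j, ?_⟩
  · ext ψ
    simp only [mem_completeTheory]
    exact ((Ultraproduct.sentence_realize ψ).trans Filter.eventually_const).symm
  · intro η J hJ hx
    have h := realize_jointlyConsistent (κ := J) (fun _ => (σ η.length).formula)
      (fun p => mk fun a => F a.1 a.2.1 (η ++ [p.1.1]) p.2)
    have h' := (los _ _).1 (h.2 (by simpa using hx))
    obtain ⟨a, ha, ha'⟩ := (h'.and (hge (η.length + 1, J, ∅))).exists
    rw [realize_jointlyConsistent] at ha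
    exact hF a.1 a.2.1 η ha'.1 J ha'.2.1 hJ (by simpa using ha)
  · intro η
    have h := realize_jointlyConsistent (κ := ULift.{max u v} (Fin η.length))
      (fun i => (σ i.down).formula)
      (fun p => mk fun a => F a.1 a.2.1 (η.take (p.1.down + 1)) p.2)
    have h' : ∃ x : Fin n → N, ∀ i : ULift.{max u v} (Fin η.length), (σ i.down).formula.Realize
        (Sum.elim x fun j => mk fun a => F a.1 a.2.1 (η.take (i.down + 1)) j) := by
      refine h.1 ((los _ _).2 ?_)
      filter_upwards [hge (η.length, ∅, ∅)] with a ha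
      obtain ⟨x, hx⟩ := hF' a.1 a.2.1 η ha.1
      exact (realize_jointlyConsistent _ _).2 ⟨x, fun i => hx i.down i.down.2⟩
    obtain ⟨x, hx⟩ := h'
    exact ⟨x, fun i => hx ⟨i⟩⟩
  · intro q r
    rw [losφ]
    have h : ∀ᶠ a in (U : Filter I), (φ.Realize (Sum.elim
        (fun j => b (a.2.2.filter (· < q)).card j) fun j => c (a.2.2.filter (· < r)).card j) ↔
          q < r) := by
      filter_upwards [hge (0, ∅, {q})] with a ha
      exact (hφ _ _).trans (hrank _ _ _ (Finset.singleton_subset_iff.1 ha.2.2))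
    rw [Filter.eventually_congr h, Filter.eventually_const]

/-- An unstable complete theory that is not supersimple has a model with a tree of instances
labelled by all its elements and an instance of the order property along the rationals. -/
theorem exists_coding_model (T : L.Theory) (hT : T.IsComplete) (hunstable : ¬ T.IsStable)
    (hnss : ¬ T.IsSupersimple) :
    ∃ (M : Type (max u v)) (_ : L.Structure M) (_ : Nonempty M), M ⊨ T ∧
      (∃ (n : ℕ) (σ : ℕ → LevelData L n) (F : List M → ℕ → M), IsInstanceTree σ F) ∧
      ∃ (nb nc : ℕ) (φ : L.Formula (Fin nb ⊕ Fin nc)) (b : ℚ → Fin nb → M)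
        (c : ℚ → Fin nc → M), OrdersBy φ b c := by
  classical
  simp only [Theory.IsStable, not_not] at hunstable
  obtain ⟨M₁, nb, nc, φ, b, c, hφ⟩ := hunstable
  simp only [Theory.IsSupersimple] at hnss
  push Not at hnss
  obtain ⟨M₂, A, n, p, hpc, hp⟩ := hnss
  obtain ⟨σ, hσ⟩ := exists_hasTree_of_forks hpc hp
  -- The order property and the forking type may live in different models. Existence of a finite
  -- tree is a sentence, so completeness of `T` moves it to `M₁`.
  have hσ₁ : ∀ d t, HasTree M₁ (d + 1) t σ fun _ => True := by
    intro d t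
    obtain ⟨τ, hτ⟩ := exists_formula_hasTree (d + 1) t σ (γ := Empty) ⊤
    have h₂ := (hτ M₂ default).2 ((hσ d t).mono fun _ _ => by simp)
    have h₁ : M₁ ⊨ τ := (hT.realize_sentence_iff τ M₁).2 ((hT.realize_sentence_iff τ M₂).1 h₂)
    exact ((hτ M₁ default).1 h₁).mono fun _ _ => trivial
  -- `Λ` has the size that the Löwenheim–Skolem theorem allows for an elementary submodel `S`
  -- containing the tree. Hence `S` embeds in `Λ`, and the elements of `S` can serve as labels.
  let Λ : Type (max u v) := (max ℵ₀ L.card).out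
  have hΛ : #Λ = max ℵ₀ L.card := mk_out _
  obtain ⟨N, _, _, hN, ⟨F, hF⟩, b', c', hφ'⟩ := exists_ultrapower_tree_order hσ₁ hφ Λ
  let s : Set N := Set.range (fun p : List Λ × ℕ => F p.1 p.2) ∪
    (Set.range (fun p : ℚ × Fin nb => b' p.1 p.2) ∪ Set.range (fun p : ℚ × Fin nc => c' p.1 p.2))
  have hs : #s ≤ #Λ := by
    have hω : ℵ₀ ≤ #Λ := hΛ ▸ le_max_left _ _
    have := infinite_iff.2 hω
    refine (mk_union_le _ _).trans (add_le_of_le hω (mk_range_le.trans ?_)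
      ((mk_union_le _ _).trans (add_le_of_le hω ?_ ?_)))
    · simp [hω]
    · exact (Set.countable_range _).le_aleph0.trans hω
    · exact (Set.countable_range _).le_aleph0.trans hω
  obtain ⟨S, hsS, hS⟩ : ∃ S : L.ElementarySubstructure N, s ⊆ S ∧ #S ≤ #Λ := by
    rcases le_total (#Λ) (#N) with h | h
    · obtain ⟨S, hS, hS'⟩ := exists_elementarySubstructure_card_eq L s (#Λ)
        (hΛ ▸ le_max_left _ _) (by simpa using hs) (by simp [hΛ]) (by simpa using h)
      exact ⟨S, hS, by simpa using hS'.le⟩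
    · exact ⟨⊤, fun _ _ => trivial, (mk_subtype_le _).trans h⟩
  obtain ⟨e⟩ := hS
  have hFS : ∀ η j, F η j ∈ S := fun η j => hsS (Or.inl ⟨(η, j), rfl⟩)
  have hbS : ∀ q j, b' q j ∈ S := fun q j => hsS (Or.inr (Or.inl ⟨(q, j), rfl⟩))
  have hcS : ∀ q j, c' q j ∈ S := fun q j => hsS (Or.inr (Or.inr ⟨(q, j), rfl⟩))
  have hreal : ∀ {m : ℕ} (ψ : L.Formula (Fin n ⊕ Fin m)) (x : Fin n → S) (y : Fin m → S),
      ψ.Realize (Sum.elim (fun i => (x i : N)) fun i => (y i : N)) ↔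
        ψ.Realize (Sum.elim x y) := by
    intro m ψ x y
    rw [← S.subtype.map_formula]
    exact iff_of_eq (congrArg _ (funext fun i => by cases i <;> rfl))
  refine ⟨S, inferInstance, inferInstance, ?_, ⟨n, σ,
    fun η j => ⟨F (η.map e) j, hFS _ _⟩, ?_, ?_⟩, nb, nc, φ, fun q j => ⟨b' q j, hbS q j⟩,
    fun q j => ⟨c' q j, hcS q j⟩, ?_⟩
  · refine ⟨fun ψ hψ => ?_⟩
    have h₁ : M₁ ⊨ ψ := T.realize_sentence_of_mem hψ
    rw [S.realize_sentence]
    rwa [← mem_completeTheory, hN, mem_completeTheory] at h₁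
  · rintro η J hJ ⟨x, hx⟩
    have h := hF.inconsistent (η.map e) (J.map e)
    rw [List.length_map, Finset.card_map] at h
    refine h hJ ⟨fun i => x i, fun a ha => ?_⟩
    obtain ⟨a, haJ, rfl⟩ := Finset.mem_map.1 ha
    have := (hreal _ _ _).2 (hx a haJ)
    simpa using this
  · intro η
    obtain ⟨x, hx⟩ := hF.consistent (η.map e)
    have h := realize_jointlyConsistent (κ := Fin η.length) (fun i => (σ i).formula)
      (fun p => (⟨F ((η.take (p.1 + 1)).map e) p.2, hFS _ _⟩ : S))
    refine h.1 ((S.subtype.map_formula _ _).1 ((realize_jointlyConsistent _ _).2 ⟨x, fun i => ?_⟩))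
    have := hx (i.cast (by simp))
    simpa [List.map_take] using this
  · intro q r
    rw [← hφ' q r, ← S.subtype.map_formula]
    exact iff_of_eq (congrArg _ (funext fun i => by cases i <;> rfl))

end CodingModel

/-! ### Saturation arguments in a coding expansion -/

/-- A set of size at most a cardinal of countable cofinality is the union of an increasing
sequence of smaller sets. -/
theorem exists_monotone_iUnion_eq_of_cof_eq_aleph0 {κ : Cardinal.{w}} (hκ : ℵ₀ ≤ κ)
    (hcof : κ.ord.cof = ℵ₀) {α : Type w} (A : Set α) (hA : #A ≤ κ) :
    ∃ B : ℕ → Set α, Monotone B ∧ A = ⋃ i, B i ∧ ∀ i, #(B i) < κ := by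
  rw [← mk_ord_toType κ] at hA
  obtain ⟨g⟩ := hA
  obtain ⟨s, hs, hsc⟩ := Order.exists_cof_eq (α := κ.ord.ToType)
  rw [Ordinal.cof_toType, hcof] at hsc
  have hs0 : s.Nonempty := by
    rw [Set.nonempty_iff_ne_empty]
    rintro rfl
    exact aleph0_ne_zero (by simpa using hsc.symm)
  obtain ⟨f, rfl⟩ := (le_aleph0_iff_set_countable.1 hsc.le).exists_eq_range hs0
  -- Preimages of initial segments of `κ.ord`, cut off along a countable cofinal sequence that
  -- partial suprema make increasing.
  refine ⟨fun i => {a | ∃ h : a ∈ A, g ⟨a, h⟩ ≤ partialSups f i}, ?_, ?_, fun i => ?_⟩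
  · rintro i j hij a ⟨h, ha⟩
    exact ⟨h, ha.trans ((partialSups f).monotone hij)⟩
  · ext a
    simp only [Set.mem_iUnion, Set.mem_ofPred_eq]
    constructor
    · intro h
      obtain ⟨_, ⟨i, rfl⟩, hi⟩ := hs (g ⟨a, h⟩)
      exact ⟨i, h, hi.trans (le_partialSups f i)⟩
    · rintro ⟨i, h, -⟩
      exact h
  · have h1 : #(Set.Iic (partialSups f i)) < κ := by
      rw [← Set.Iio_insert]
      refine (mk_insert_le).trans_lt (add_lt_of_lt hκ ?_ (one_lt_aleph0.trans_le hκ))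
      exact (mk_Iio_lt _ (by simp)).trans_eq (mk_ord_toType κ)
    refine lt_of_le_of_lt (mk_le_of_injective (f := fun a : {a | ∃ h : a ∈ A,
      g ⟨a, h⟩ ≤ partialSups f i} => (⟨g ⟨a, a.2.1⟩, a.2.2⟩ : Set.Iic (partialSups f i))) ?_) h1
    intro a b hab
    simpa [Subtype.ext_iff] using hab

variable {L : Language.{u, v}} {M : Type w} [L.Structure M]

/-- In a saturated structure, consistent families of instances over few parameters are
realized. -/
theorem IsSaturated.exists_realize {κ : Cardinal.{w}} (hM : IsSaturated L κ M) {ι : Type*} {n : ℕ}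
    {m : ι → ℕ} (ψ : ∀ i, L.Formula (Fin n ⊕ Fin (m i))) (y : ∀ i, Fin (m i) → M)
    (A : Set M) (hA : #A < κ) (hy : ∀ i j, y i j ∈ A)
    (hfin : ∀ s : Finset ι, ∃ x : Fin n → M, ∀ i ∈ s, (ψ i).Realize (Sum.elim x (y i))) :
    ∃ x : Fin n → M, ∀ i, (ψ i).Realize (Sum.elim x (y i)) := by
  classical
  -- Saturation speaks of complete types only; an ultrafilter of tuples containing all solution sets
  -- completes the given family.
  obtain ⟨U, hU⟩ := Ultrafilter.exists_ultrafilter_of_finite_inter_nonempty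
    (Set.range fun i => {x : Fin n → M | (ψ i).Realize (Sum.elim x (y i))}) (by
      intro T hT
      obtain ⟨s, hs, rfl⟩ := Finset.subset_set_image_iff.1 (Set.image_univ ▸ hT)
      obtain ⟨x, hx⟩ := hfin s
      exact ⟨x, by simpa using hx⟩)
  obtain ⟨x, hx⟩ := hM A hA n
    {φ | ∀ᶠ x in (U : Filter (Fin n → M)), φ.Realize (Sum.elim x fun a : A => (a : M))}
    ⟨fun p₀ hp₀ => ((Filter.eventually_all_finset p₀).2 fun φ hφ => hp₀ hφ).exists, fun φ => by
      simp only [Set.mem_ofPred_eq, Formula.realize_not]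
      exact (U.eventually_or).1 (Filter.Eventually.of_forall fun x => em _)⟩
  refine ⟨x, fun i => ?_⟩
  have hreal : ∀ x : Fin n → M, ((ψ i).relabel (Sum.map id fun j => (⟨y i j, hy i j⟩ : A))).Realize
      (Sum.elim x fun a : A => (a : M)) ↔ (ψ i).Realize (Sum.elim x (y i)) := by
    intro x
    rw [Formula.realize_relabel, Sum.elim_comp_map]
    rfl
  refine (hreal x).1 (hx _ ?_)
  simp only [Set.mem_ofPred_eq, hreal]
  exact hU ⟨i, rfl⟩

variable (L M) in
/-- An expansion of a structure by a copy of a nonstandard model of arithmetic and functions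
that decode sequences of elements from tuples realizing instances of a tree and of an order. -/
structure CodingExpansion where
  num : ℕ → M
  le : M → M → Prop
  inf : M
  (nb nc : ℕ)
  φ : L.Formula (Fin nb ⊕ Fin nc)
  B : M → Fin nb → M
  node : List ℕ → Fin nb → M
  n : ℕ
  σ : ℕ → LevelData L n
  F : ∀ i, (Fin (i + 1) → M) → ℕ → M
  G : ∀ i, (Fin n → M) → (Fin i → M) → M → M
  R : (Fin nc → M) → M → M
  dec : (Fin n → M) → (Fin nc → M) → M → M
  proj : ∀ k, Fin k → M → M
  num_injective : Function.Injective num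
  le_num_iff : ∀ x k, le x (num k) ↔ ∃ j ≤ k, x = num j
  -- Numbers are not a separate sort: `le x x` expresses that `x` is a number.
  le_left : ∀ x y, le x y → le x x
  le_right : ∀ x y, le x y → le y y
  le_total : ∀ x y, le x x → le y y → le x y ∨ le y x
  le_antisymm : ∀ x y, le x y → le y x → x = y
  le_trans : ∀ x y z, le x y → le y z → le x z
  le_inf : le inf inf
  inf_ne : ∀ k, inf ≠ num k
  exists_pred : ∀ x, le x x → x = num 0 ∨ ∃ y, le y x ∧ y ≠ x ∧ ∀ z, le z x → z ≠ x → le z y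
  order : ∀ h, le h h → ∃ y, ∀ i, le i i → (φ.Realize (Sum.elim (B i) y) ↔ le i h ∧ i ≠ h)
  order_least : ∀ y i, le i i → ¬ φ.Realize (Sum.elim (B i) y) → ∃ j, le j j ∧
    ¬ φ.Realize (Sum.elim (B j) y) ∧ ∀ l, le l j → l ≠ j → φ.Realize (Sum.elim (B l) y)
  exists_path : ∀ (f : ℕ → ℕ) (k : ℕ), ∃ e, ∀ i < k,
    φ.Realize (Sum.elim (node ((List.range i).map f ++ [f i])) e) ∧
    ∀ j < f i, ¬ φ.Realize (Sum.elim (node ((List.range i).map f ++ [j])) e)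
  R_eq : ∀ (f : ℕ → ℕ) (k : ℕ) (e), (∀ i ≤ k,
    φ.Realize (Sum.elim (node ((List.range i).map f ++ [f i])) e) ∧
    ∀ j < f i, ¬ φ.Realize (Sum.elim (node ((List.range i).map f ++ [j])) e)) →
    R e (num k) = num (f k)
  exists_branch : ∀ (k : ℕ) (y : ℕ → M), ∃ x, ∀ i < k,
    (σ i).formula.Realize (Sum.elim x fun j => F i (fun l => y l) j)
  exists_eq_G : ∀ (i : ℕ) (x) (y : ℕ → M),
    (σ i).formula.Realize (Sum.elim x fun j => F i (fun l => y l) j) →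
    ∃ j, y i = G i x (fun l => y l) (num j)
  dec_num : ∀ x e i, dec x e (num i) = G i x (fun j : Fin i => dec x e (num j)) (R e (num i))
  exists_proj : ∀ k (x : Fin k → M), ∃ y, ∀ i, proj k i y = x i
  least : ∀ {k m : ℕ} (θ : L.Formula (Fin k ⊕ Fin m)) (a : Fin m → M) (x e i i₀), le i₀ i →
    ¬ θ.Realize (Sum.elim (fun j => proj k j (dec x e i)) a) → ∃ h, le i₀ h ∧
      ¬ θ.Realize (Sum.elim (fun j => proj k j (dec x e h)) a) ∧
      ∀ l, le i₀ l → le l h → l ≠ h → θ.Realize (Sum.elim (fun j => proj k j (dec x e l)) a)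

namespace CodingExpansion

variable (C : CodingExpansion L M) {κ : Cardinal.{w}}

/-- The nonstandard numbers of a coding expansion. -/
def Nonstandard (x : M) : Prop := C.le x x ∧ ∀ k, x ≠ C.num k

variable {C}

theorem Nonstandard.num_le {x : M} (hx : C.Nonstandard x) (k : ℕ) : C.le (C.num k) x := by
  rcases C.le_total (C.num k) x ((C.le_num_iff _ _).2 ⟨k, le_rfl, rfl⟩) hx.1 with h | h
  · exact h
  · obtain ⟨j, -, rfl⟩ := (C.le_num_iff _ _).1 h
    exact absurd rfl (hx.2 j)

variable (C) in
theorem nonstandard_inf : C.Nonstandard C.inf := ⟨C.le_inf, C.inf_ne⟩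

/-- The predecessor works: were it a standard `k`, then `k + 1`, which lies strictly below `x`,
would be at most `k`. -/
theorem Nonstandard.exists_lt {x : M} (hx : C.Nonstandard x) :
    ∃ y, C.Nonstandard y ∧ C.le y x ∧ y ≠ x := by
  obtain ⟨y, hyx, hne, hy⟩ := (C.exists_pred x hx.1).resolve_left (hx.2 0)
  refine ⟨y, ⟨C.le_left _ _ hyx, fun k hk => ?_⟩, hyx, hne⟩
  subst hk
  obtain ⟨j, hj, h⟩ := (C.le_num_iff _ _).1 (hy _ (hx.num_le (k + 1)) (hx.2 (k + 1)).symm)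
  have := C.num_injective h
  omega

/-- Few nonstandard numbers have a nonstandard strict lower bound. -/
theorem exists_lower_bound_of_lt (hM : IsSaturated L κ M) (hκ : ℵ₀ < κ) (H : Set M)
    (hH : ∀ h ∈ H, C.Nonstandard h) (hHκ : #H < κ) :
    ∃ x, C.Nonstandard x ∧ ∀ h ∈ H, C.le x h ∧ x ≠ h := by
  classical
  -- Adding `inf` guarantees a number at which the order formula fails, even when `H` is empty.
  let H' : Set M := insert C.inf H
  have hH' : ∀ h ∈ H', C.Nonstandard h := by
    rintro h (rfl | hh)
    exacts [C.nonstandard_inf, hH h hh]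
  let φ' : L.Formula (Fin C.nc ⊕ Fin C.nb) := C.φ.relabel Sum.swap
  have hφ' : ∀ (y : Fin C.nc → M) (b : Fin C.nb → M), φ'.Realize (Sum.elim y b) ↔
      C.φ.Realize (Sum.elim b y) := by
    intro y b
    simp only [φ', Formula.realize_relabel]
    exact iff_of_eq (congrArg _ (funext fun i => by cases i <;> rfl))
  let D : Set M := H' ∪ Set.range C.num
  have hD : #D < κ := (mk_union_le _ _).trans_lt (add_lt_of_lt hκ.le
    (mk_insert_le.trans_lt (add_lt_of_lt hκ.le hHκ (one_lt_aleph0.trans hκ)))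
    ((Set.countable_range _).le_aleph0.trans_lt hκ))
  -- The cut of `y` is to lie above all standard numbers and not above any element of `H'`. For
  -- finitely many conditions, the cut at the least element of `H'` involved will do.
  obtain ⟨y, hy⟩ := hM.exists_realize (ι := ℕ ⊕ H')
    (fun i => Sum.elim (fun _ => φ') (fun _ => φ'.not) i)
    (fun i => Sum.elim (fun k => C.B (C.num k)) (fun h => C.B h) i)
    (⋃ d : D, Set.range (C.B d)) (by
      refine (mk_iUnion_le_sum_mk.trans (sum_le_mk_mul_iSup _)).trans_lt
        (mul_lt_of_lt hκ.le hD (lt_of_le_of_lt (ciSup_le' fun d => ?_) hκ))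
      exact (Set.countable_range _).le_aleph0)
    (by
      rintro (k | h) j
      · exact Set.mem_iUnion.2 ⟨⟨_, Or.inr ⟨k, rfl⟩⟩, j, rfl⟩
      · exact Set.mem_iUnion.2 ⟨⟨_, Or.inl h.2⟩, j, rfl⟩) (by
      intro s
      have hmin : ∀ s : Finset (ℕ ⊕ H'), ∃ h, C.Nonstandard h ∧
          ∀ h' : H', Sum.inr h' ∈ s → C.le h h' := by
        intro s
        induction s using Finset.induction_on with
        | empty => exact ⟨C.inf, C.nonstandard_inf, by simp⟩
        | insert a s _ ih =>
          obtain ⟨h, hh, hs⟩ := ih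
          rcases a with k | a
          · exact ⟨h, hh, fun h' hh' => hs h' (by simpa using hh')⟩
          · have ha := hH' a a.2
            rcases C.le_total h a hh.1 ha.1 with hle | hle
            · refine ⟨h, hh, fun h' hh' => ?_⟩
              rcases Finset.mem_insert.1 hh' with e | e
              · rw [Sum.inr.inj e]; exact hle
              · exact hs h' e
            · refine ⟨a, ha, fun h' hh' => ?_⟩
              rcases Finset.mem_insert.1 hh' with e | e
              · rw [Sum.inr.inj e]; exact ha.1
              · exact C.le_trans _ _ _ hle (hs h' e)
      obtain ⟨h, hh, hs⟩ := hmin s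
      obtain ⟨y, hy⟩ := C.order h hh.1
      refine ⟨y, ?_⟩
      rintro (k | h') hi
      · refine (hφ' _ _).2 ((hy _ ?_).2 ⟨hh.num_le k, (hh.2 k).symm⟩)
        exact (C.le_num_iff _ _).2 ⟨k, le_rfl, rfl⟩
      · refine Formula.realize_not.2 fun hr => ?_
        have := (hy _ (hH' h' h'.2).1).1 ((hφ' _ _).1 hr)
        exact this.2 (C.le_antisymm _ _ this.1 (hs h' hi)))
  have hnum : ∀ k, C.φ.Realize (Sum.elim (C.B (C.num k)) y) := fun k => (hφ' _ _).1 (hy (Sum.inl k))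
  have hneg : ∀ h ∈ H', ¬ C.φ.Realize (Sum.elim (C.B h) y) := fun h hh hr =>
    Formula.realize_not.1 (hy (Sum.inr ⟨h, hh⟩)) ((hφ' _ _).2 hr)
  -- The first number beyond the cut is nonstandard and at most every element of `H`; passing to a
  -- smaller nonstandard number makes the bound strict.
  obtain ⟨j, hj, hjn, hjl⟩ := C.order_least y C.inf C.le_inf (hneg _ (Or.inl rfl))
  have hjN : C.Nonstandard j := ⟨hj, fun k hk => hjn (hk ▸ hnum k)⟩
  obtain ⟨x, hx, hxj, hne⟩ := hjN.exists_lt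
  have hjH : ∀ h ∈ H, C.le j h := by
    intro h hh
    rcases C.le_total j h hj (hH h hh).1 with hle | hle
    · exact hle
    · by_cases he : h = j
      · rw [he]; exact hj
      · exact absurd (hjl h hle he) (hneg h (Or.inr hh))
  refine ⟨x, hx, fun h hh => ⟨C.le_trans _ _ _ hxj (hjH h hh), ?_⟩⟩
  rintro rfl
  exact hne (C.le_antisymm _ _ hxj (hjH x hh))

/-- At a cardinal of countable cofinality, the bound on the number of nonstandard numbers need
not be strict. -/
theorem exists_lower_bound_of_le (hM : IsSaturated L κ M) (hκ : ℵ₀ < κ) (hcof : κ.ord.cof = ℵ₀)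
    (H : Set M) (hH : ∀ h ∈ H, C.Nonstandard h) (hHκ : #H ≤ κ) :
    ∃ x, C.Nonstandard x ∧ ∀ h ∈ H, C.le x h ∧ x ≠ h := by
  obtain ⟨S, -, rfl, hS⟩ := exists_monotone_iUnion_eq_of_cof_eq_aleph0 hκ.le hcof H hHκ
  choose z hz hzS using fun i => exists_lower_bound_of_lt hM hκ (S i)
    (fun h hh => hH h (Set.mem_iUnion.2 ⟨i, hh⟩)) (hS i)
  obtain ⟨x, hx, hxz⟩ := exists_lower_bound_of_lt hM hκ (Set.range z)
    (by rintro _ ⟨i, rfl⟩; exact hz i) ((Set.countable_range z).le_aleph0.trans_lt hκ)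
  refine ⟨x, hx, fun h hh => ?_⟩
  obtain ⟨i, hi⟩ := Set.mem_iUnion.1 hh
  have h1 := hxz _ ⟨i, rfl⟩
  have h2 := hzS i h hi
  refine ⟨C.le_trans _ _ _ h1.1 h2.1, ?_⟩
  rintro rfl
  exact h1.2 (C.le_antisymm _ _ h1.1 h2.1)

variable (C) in
/-- Every sequence of elements is decoded from some tuples. -/
theorem exists_dec_eq (hM : IsSaturated L κ M) (hκ : ℵ₀ < κ) (s : ℕ → M) :
    ∃ x e, ∀ i, C.dec x e (C.num i) = s i := by
  obtain ⟨x, hx⟩ := hM.exists_realize (fun i => (C.σ i).formula)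
    (fun i j => C.F i (fun l => s l) j) (⋃ i, Set.range fun j : Fin (C.σ i).arity =>
      C.F i (fun l => s l) j)
    ((Set.countable_iUnion fun _ => Set.countable_range _).le_aleph0.trans_lt hκ)
    (fun i j => Set.mem_iUnion.2 ⟨i, j, rfl⟩) (fun t => by
      obtain ⟨x, hx⟩ := C.exists_branch (t.sup id + 1) s
      exact ⟨x, fun i hi => hx i (Nat.lt_succ_of_le (Finset.le_sup (f := id) hi))⟩)
  -- `f i` is the standard position of `s i` among the labels compatible with `x` after the first
  -- `i` terms; it remains to code `f`.
  choose f hf using fun i => C.exists_eq_G i x s (hx i)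
  let φ' : L.Formula (Fin C.nc ⊕ Fin C.nb) := C.φ.relabel Sum.swap
  have hφ' : ∀ (y : Fin C.nc → M) (b : Fin C.nb → M), φ'.Realize (Sum.elim y b) ↔
      C.φ.Realize (Sum.elim b y) := by
    intro y b
    simp only [φ', Formula.realize_relabel]
    exact iff_of_eq (congrArg _ (funext fun i => by cases i <;> rfl))
  obtain ⟨e, he⟩ := hM.exists_realize (ι := ℕ × ℕ)
    -- Among the children of the node reached by `f`, child `f i` must be the first below the cut;
    -- later children are left free.
    (fun p => if p.2 = f p.1 then φ' else if p.2 < f p.1 then φ'.not else ⊤)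
    (fun p => C.node ((List.range p.1).map f ++ [p.2]))
    (⋃ p : ℕ × ℕ, Set.range (C.node ((List.range p.1).map f ++ [p.2])))
    ((Set.countable_iUnion fun _ => Set.countable_range _).le_aleph0.trans_lt hκ)
    (fun p j => Set.mem_iUnion.2 ⟨p, j, rfl⟩) (fun t => by
      obtain ⟨e, he⟩ := C.exists_path f (t.sup Prod.fst + 1)
      refine ⟨e, fun p hp => ?_⟩
      have := he p.1 (Nat.lt_succ_of_le (Finset.le_sup (f := Prod.fst) hp))
      split_ifs with h1 h2
      · rw [hφ', h1]; exact this.1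
      · rw [Formula.realize_not, hφ']; exact this.2 _ h2
      · exact Formula.realize_top.2 trivial)
  have hR : ∀ k, C.R e (C.num k) = C.num (f k) := by
    refine fun k => C.R_eq f k e fun i _ => ⟨?_, fun j hj => ?_⟩
    · have := he (i, f i)
      rw [if_pos rfl, hφ'] at this
      exact this
    · have := he (i, j)
      rw [if_neg hj.ne, if_pos hj, Formula.realize_not, hφ'] at this
      exact this
  refine ⟨x, e, fun i => ?_⟩
  induction i using Nat.strong_induction_on with
  | _ i ih =>
    rw [C.dec_num, hR, hf]
    congr 1
    funext j
    exact ih j j.2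

end CodingExpansion

/-- A formula uses only finitely many of its parameters. -/
theorem Formula.exists_fin_params {α β : Type*} (θ : L.Formula (α ⊕ β)) :
    ∃ (m : ℕ) (b : Fin m → β) (θ' : L.Formula (α ⊕ Fin m)), ∀ (x : α → M) (y : β → M),
      θ'.Realize (Sum.elim x (y ∘ b)) ↔ θ.Realize (Sum.elim x y) := by
  obtain ⟨B, hB, φ, hφ⟩ := θ.exists_restrict_params
  have := hB.to_subtype
  obtain ⟨m, ⟨e⟩⟩ := Finite.exists_equiv_fin B
  refine ⟨m, fun i => e.symm i, φ.relabel (Sum.map id e), fun x y => ?_⟩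
  rw [← hφ, Formula.realize_relabel, Sum.elim_comp_map]
  exact iff_of_eq (congrArg _ (congrArg _ (funext fun b => by simp)))

/-- Saturation at a singular cardinal of countable cofinality passes to the successor in the
presence of a coding expansion. -/
theorem CodingExpansion.isSaturated_succ (C : CodingExpansion L M) {κ : Cardinal.{w}}
    (hκ : ℵ₀ < κ) (hcof : κ.ord.cof = ℵ₀)
    (hL : lift.{w} L.card ≤ lift.{max u v} κ) (hM : IsSaturated L κ M) :
    IsSaturated L (Order.succ κ) M := by
  intro A hA n p hp
  rw [Order.lt_succ_iff] at hA
  obtain ⟨S, hSmono, hAS, hSκ⟩ := exists_monotone_iUnion_eq_of_cof_eq_aleph0 hκ.le hcof A hA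
  choose m b θ hθ using fun φ : L.Formula (Fin n ⊕ A) => φ.exists_fin_params (M := M)
  have hd : ∀ i, ∃ d : Fin n → M, ∀ φ ∈ p, (∀ j, (b φ j : M) ∈ S i) →
      (θ φ).Realize (Sum.elim d fun j => (b φ j : M)) := by
    intro i
    obtain ⟨d, hd⟩ := hM.exists_realize (ι := {φ // φ ∈ p ∧ ∀ j, (b φ j : M) ∈ S i})
      (fun φ => θ φ.1) (fun φ j => (b φ.1 j : M)) (S i) (hSκ i) (fun φ j => φ.2.2 j) (fun s => by
        classical
        obtain ⟨x, hx⟩ := hp.1 (s.image Subtype.val) (by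
          intro φ hφ
          obtain ⟨ψ, -, rfl⟩ := Finset.mem_image.1 hφ
          exact ψ.2.1)
        exact ⟨x, fun φ hφ => (hθ _ _ _).2 (hx _ (Finset.mem_image_of_mem _ hφ))⟩)
    exact ⟨d, fun φ h1 h2 => hd ⟨φ, h1, h2⟩⟩
  choose d hd using hd
  choose s hs using fun i => C.exists_proj n (d i)
  -- From here on the sequence of partial realizations is also defined at nonstandard indices.
  obtain ⟨x, e, hxe⟩ := C.exists_dec_eq hM hκ s
  let P : L.Formula (Fin n ⊕ A) → M → Prop := fun φ i =>
    (θ φ).Realize (Sum.elim (fun j => C.proj n j (C.dec x e i)) fun j => (b φ j : M))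
  have hstart : ∀ φ, ∃ i₀, ∀ i ≥ i₀, ∀ j, (b φ j : M) ∈ S i := by
    intro φ
    have : ∀ j, ∃ i, (b φ j : M) ∈ S i := fun j => Set.mem_iUnion.1 (hAS.subset (b φ j).2)
    choose i hi using this
    exact ⟨Finset.univ.sup i, fun i' hi' j =>
      hSmono ((Finset.le_sup (Finset.mem_univ j)).trans hi') (hi j)⟩
  choose i₀ hi₀ using hstart
  have hPnum : ∀ φ ∈ p, ∀ i ≥ i₀ φ, P φ (C.num i) := by
    intro φ hφ i hi
    simp only [P, hxe, hs]
    exact hd i φ hφ (hi₀ φ i hi)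
  have hfail : ∀ φ : p, ∃ h, C.Nonstandard h ∧
      ∀ l, C.le (C.num (i₀ φ)) l → C.le l h → l ≠ h → P φ l := by
    rintro ⟨φ, hφ⟩
    by_cases hex : ∃ i, C.le (C.num (i₀ φ)) i ∧ ¬ P φ i
    · obtain ⟨i, hi, hPi⟩ := hex
      obtain ⟨h, h1, h2, h3⟩ := C.least (θ φ) (fun j => (b φ j : M)) x e i _ hi hPi
      refine ⟨h, ⟨C.le_right _ _ h1, ?_⟩, h3⟩
      rintro k rfl
      obtain ⟨j, hj, hjk⟩ := (C.le_num_iff _ _).1 h1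
      rw [← C.num_injective hjk] at hj
      exact h2 (hPnum φ hφ k hj)
    -- A formula that never fails needs no bound; `inf` is a harmless nonstandard choice.
    · push Not at hex
      exact ⟨C.inf, C.nonstandard_inf, fun l hl _ _ => hex l hl⟩
  choose h hh hhP using hfail
  have hcard : #(Set.range h) ≤ κ := by
    have h1 : lift.{max u v w} #(Set.range h) ≤ lift.{w} #p := mk_range_le_lift
    have h2 : #p ≤ lift.{max u v} κ := by
      refine (mk_set_le p).trans ?_
      refine (mk_le_of_injective (f := fun φ : L.Formula (Fin n ⊕ A) =>
        (⟨0, φ⟩ : Σ k, L.BoundedFormula (Fin n ⊕ A) k)) fun a b hab => by simpa using hab).trans ?_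
      refine BoundedFormula.card_le.trans (max_le (by simpa using hκ.le) (add_le_of_le
        (by simpa using hκ.le) ?_ hL))
      rw [lift_le, mk_sum]
      refine add_le_of_le hκ.le ?_ (by simpa using hA)
      simpa using (natCast_lt_aleph0.trans hκ).le
    exact lift_le.1 (h1.trans ((lift_le.2 h2).trans_eq (by simp)))
  obtain ⟨N, hN, hNh⟩ := exists_lower_bound_of_le hM hκ hcof (Set.range h)
    (by rintro _ ⟨φ, rfl⟩; exact hh φ) hcard
  refine ⟨fun j => C.proj n j (C.dec x e N), fun φ hφ => (hθ φ _ _).1 ?_⟩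
  have := hNh _ ⟨⟨φ, hφ⟩, rfl⟩
  exact hhP ⟨φ, hφ⟩ N (hN.num_le _) this.1 this.2

/-! ### Rational positions of finite sequences, and recursion on previous values -/

section Positions

/-- The position in the unit interval of a node of the tree of finite sequences of natural
numbers. The nodes below the children of a node occupy disjoint intervals, in decreasing order. -/
def treePos : List ℕ → ℚ
  | [] => 0
  -- The unit interval is rescaled onto `[1/(j+2), 1/(j+1))`.
  | j :: l => 1 / (j + 2) + treePos l * (1 / (j + 1) - 1 / (j + 2))

theorem interval_length_pos (j : ℕ) : (0 : ℚ) < 1 / (j + 1) - 1 / (j + 2) := by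
  rw [sub_pos]
  exact one_div_lt_one_div_of_lt (by positivity) (by linarith)

theorem treePos_nonneg (l : List ℕ) : 0 ≤ treePos l := by
  induction l with
  | nil => exact le_rfl
  | cons j l ih =>
    have := interval_length_pos j
    simp only [treePos]
    positivity

theorem treePos_pos {l : List ℕ} (hl : l ≠ []) : 0 < treePos l := by
  cases l with
  | nil => exact absurd rfl hl
  | cons j l =>
    have := interval_length_pos j
    have := treePos_nonneg l
    simp only [treePos]
    positivity

theorem treePos_cons_lt (j : ℕ) {l : List ℕ} (hl : treePos l < 1) :
    treePos (j :: l) < 1 / (j + 1) := by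
  have := interval_length_pos j
  simp only [treePos]
  nlinarith

theorem treePos_lt_one (l : List ℕ) : treePos l < 1 := by
  induction l with
  | nil => exact one_pos
  | cons j l ih =>
    refine (treePos_cons_lt j ih).trans_le ?_
    rw [div_le_one (by positivity)]
    linarith [(Nat.cast_nonneg j : (0 : ℚ) ≤ j)]

theorem treePos_append_mono (ν : List ℕ) {l l' : List ℕ} (h : treePos l ≤ treePos l') :
    treePos (ν ++ l) ≤ treePos (ν ++ l') := by
  induction ν with
  | nil => exact h
  | cons j ν ih =>
    have := interval_length_pos j
    simp only [List.cons_append, treePos]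
    gcongr

theorem treePos_append_strictMono (ν : List ℕ) {l l' : List ℕ} (h : treePos l < treePos l') :
    treePos (ν ++ l) < treePos (ν ++ l') := by
  induction ν with
  | nil => exact h
  | cons j ν ih =>
    have := interval_length_pos j
    simp only [List.cons_append, treePos]
    gcongr

/-- Together with `treePos_le_of_lt`, this shows that a cut at the position of a long path
determines the path: a prefix lies strictly below it, and the siblings of smaller index lie at or
above it. Each entry is thus the least child below the cut. -/
theorem treePos_lt_of_prefix (ν : List ℕ) (j : ℕ) {l : List ℕ} (hl : l ≠ []) :
    treePos (ν ++ [j]) < treePos (ν ++ j :: l) := by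
  refine treePos_append_strictMono ν ?_
  have := interval_length_pos j
  have := treePos_pos hl
  simp only [treePos]
  nlinarith

theorem treePos_le_of_lt (ν : List ℕ) {i j : ℕ} (hij : i < j) (l : List ℕ) :
    treePos (ν ++ j :: l) ≤ treePos (ν ++ [i]) := by
  refine treePos_append_mono ν ((treePos_cons_lt j (treePos_lt_one l)).le.trans ?_)
  simp only [treePos, zero_mul, add_zero]
  have : (i : ℚ) + 1 ≤ j := by exact_mod_cast hij
  exact one_div_le_one_div_of_le (by positivity) (by linarith)

/-- The sequence whose terms are computed from the previous ones. -/
def courseOfValues {X : Type*} (g : ∀ i, (Fin i → X) → X) (i : ℕ) : X :=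
  g i fun j => courseOfValues g j
termination_by i
decreasing_by exact j.2

theorem courseOfValues_eq {X : Type*} (g : ∀ i, (Fin i → X) → X) (i : ℕ) :
    courseOfValues g i = g i fun j => courseOfValues g j := by
  rw [courseOfValues]

end Positions

/-! ### Expansions by function symbols -/

section FunctionSymbols

variable {L : Language.{u, v}} {S : Type} {ar : S → Type} [∀ s, Fintype (ar s)]

/-- The language with function symbols `S`, where `s : S` takes arguments indexed by `ar s`. -/
def functionLanguage {S : Type} (ar : S → Type) [∀ s, Fintype (ar s)] : Language.{u, v} where
  Functions k := ULift.{u} {s : S // Fintype.card (ar s) = k}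
  Relations _ := PEmpty

theorem card_functionLanguage_le [Countable S] : (functionLanguage.{u, v} ar).card ≤ ℵ₀ := by
  rw [Language.card, mk_le_aleph0_iff]
  have : ∀ k, Countable ((functionLanguage.{u, v} ar).Functions k) := fun k =>
    inferInstanceAs (Countable (ULift {s : S // Fintype.card (ar s) = k}))
  have : ∀ k, Countable ((functionLanguage.{u, v} ar).Relations k) := fun k =>
    inferInstanceAs (Countable PEmpty)
  exact inferInstanceAs (Countable (_ ⊕ _))

/-- The structure given by an interpretation of the function symbols. -/
@[reducible]
noncomputable def functionStructure {N : Type*} (I : ∀ s, (ar s → N) → N) :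
    (functionLanguage.{u, v} ar).Structure N where
  funMap f x := I f.down.1 fun a => x (Fin.cast f.down.2 (Fintype.equivFin _ a))
  RelMap r := PEmpty.elim r

variable (L ar) in
/-- The expansion of a language by function symbols. -/
abbrev withFunctions : Language.{u, v} := L.sum (functionLanguage.{u, v} ar)

variable (L) in
/-- The interpretation of a function symbol. -/
noncomputable def interp {N : Type*} [(L.withFunctions ar).Structure N]
    (s : S) (x : ar s → N) : N :=
  Structure.funMap (L := L.withFunctions ar) (Sum.inr ⟨⟨s, rfl⟩⟩) fun i =>
    x ((Fintype.equivFin _).symm i)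

theorem interp_functionStructure {N : Type*} [L.Structure N] (I : ∀ s, (ar s → N) → N) (s : S)
    (x : ar s → N) :
    @interp L S ar _ N (@sumStructure L (functionLanguage ar) N _ (functionStructure I)) s x =
      I s x := by
  change I s (fun a => x ((Fintype.equivFin _).symm (Fintype.equivFin _ a))) = I s x
  simp

/-- The term obtained by applying a function symbol. -/
noncomputable def app {α : Type*} (s : S) (t : ar s → (L.withFunctions ar).Term α) :
    (L.withFunctions ar).Term α :=
  Term.func (Sum.inr ⟨⟨s, rfl⟩⟩) fun i => t ((Fintype.equivFin _).symm i)

@[simp]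
theorem realize_app {α : Type*} {N : Type*} [(L.withFunctions ar).Structure N] (s : S)
    (t : ar s → (L.withFunctions ar).Term α) (y : α → N) :
    (app s t).realize y = interp L s fun a => (t a).realize y := rfl

variable (ar) in
/-- The instance of a formula of the original language at terms of the expansion. -/
noncomputable def Formula.atTerms {α β : Type*} (χ : L.Formula α)
    (t : α → (L.withFunctions ar).Term β) : (L.withFunctions ar).Formula β :=
  BoundedFormula.subst ((LHom.sumInl : L →ᴸ L.withFunctions ar).onFormula χ) t

@[simp]
theorem Formula.realize_atTerms {α β : Type*} (χ : L.Formula α)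
    (t : α → (L.withFunctions ar).Term β) {N : Type*} [L.Structure N]
    [(L.withFunctions ar).Structure N]
    [(LHom.sumInl : L →ᴸ L.withFunctions ar).IsExpansionOn N] (y : β → N) :
    (χ.atTerms ar t).Realize y ↔ χ.Realize fun a => (t a).realize y := by
  rw [Formula.atTerms, Formula.Realize, BoundedFormula.realize_subst]
  exact LHom.realize_onFormula _ _

end FunctionSymbols

/-! ### Universal closures -/

section Transfer

variable {L : Language.{u, v}}

open Classical in
/-- The universal closure of a formula. -/
noncomputable def Formula.universalClosure {α : Type*} (φ : L.Formula α) : L.Sentence :=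
  Formula.iAlls φ.freeVarFinset
    (φ.restrictFreeVar (Sum.inr : φ.freeVarFinset → Empty ⊕ φ.freeVarFinset))

theorem Formula.realize_universalClosure {α : Type*} (φ : L.Formula α) {N : Type*}
    [L.Structure N] [Nonempty N] : N ⊨ φ.universalClosure ↔ ∀ y : α → N, φ.Realize y := by
  classical
  rw [Sentence.Realize, Formula.universalClosure, Formula.realize_iAlls]
  constructor
  · intro h y
    refine (BoundedFormula.realize_restrictFreeVar (φ := φ)
      (f := (Sum.inr : φ.freeVarFinset → Empty ⊕ φ.freeVarFinset)) y fun a => ?_).1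
      (h fun a => y a)
    rfl
  · intro h y
    refine (BoundedFormula.realize_restrictFreeVar (φ := φ)
      (f := (Sum.inr : φ.freeVarFinset → Empty ⊕ φ.freeVarFinset))
      (fun a => if ha : a ∈ φ.freeVarFinset then y ⟨a, ha⟩ else Classical.arbitrary N)
      fun a => ?_).2 (h _)
    simp

end Transfer

/-! ### The coding language: symbols, interpretations and terms -/

/-- The function symbols used for coding. -/
inductive CodingSymbol (nb nc n : ℕ) : Type
  | num (k : ℕ)
  | le
  | inf
  | B (j : Fin nb)
  | node (l : List ℕ) (j : Fin nb)
  | F (i j : ℕ)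
  | G (i : ℕ)
  | R
  | dec
  | proj (k : ℕ) (j : Fin k)

namespace CodingSymbol

variable {nb nc n : ℕ}

/-- The type of arguments of a symbol. -/
@[reducible]
def Arity : CodingSymbol nb nc n → Type
  | num _ => Empty
  | le => Fin 2
  | inf => Empty
  | B _ => Unit
  | node _ _ => Empty
  | F i _ => Fin (i + 1)
  | G i => Fin n ⊕ Fin i ⊕ Unit
  | R => Fin nc ⊕ Unit
  | dec => Fin n ⊕ Fin nc ⊕ Unit
  | proj _ _ => Unit

instance : ∀ s : CodingSymbol nb nc n, Fintype s.Arity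
  | num _ => inferInstanceAs (Fintype Empty)
  | le => inferInstanceAs (Fintype (Fin 2))
  | inf => inferInstanceAs (Fintype Empty)
  | B _ => inferInstanceAs (Fintype Unit)
  | node _ _ => inferInstanceAs (Fintype Empty)
  | F i _ => inferInstanceAs (Fintype (Fin (i + 1)))
  | G i => inferInstanceAs (Fintype (Fin n ⊕ Fin i ⊕ Unit))
  | R => inferInstanceAs (Fintype (Fin nc ⊕ Unit))
  | dec => inferInstanceAs (Fintype (Fin n ⊕ Fin nc ⊕ Unit))
  | proj _ _ => inferInstanceAs (Fintype Unit)

/-- An injective code of symbols. -/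
def code : CodingSymbol nb nc n → ℕ × List ℕ
  | num k => (0, [k])
  | le => (1, [])
  | inf => (2, [])
  | B j => (3, [j])
  | node l j => (4, j :: l)
  | F i j => (5, [i, j])
  | G i => (6, [i])
  | R => (7, [])
  | dec => (8, [])
  | proj k j => (9, [k, j])

theorem code_injective : Function.Injective (code : CodingSymbol nb nc n → ℕ × List ℕ) := by
  intro s s' h
  cases s <;> cases s' <;> simp [code, Fin.val_inj] at h ⊢ <;> try grind
  obtain ⟨rfl, h⟩ := h
  exact ⟨rfl, heq_of_eq (Fin.ext h)⟩

instance : Countable (CodingSymbol nb nc n) := code_injective.countable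

end CodingSymbol

section Operations

variable (L : Language.{u, v}) (nb nc n : ℕ)

/-- The expansion of a language by the symbols used for coding. -/
abbrev withCoding : Language.{u, v} :=
  L.withFunctions (CodingSymbol.Arity : CodingSymbol nb nc n → Type)

variable {L nb nc n}
variable {N : Type*} [(L.withCoding nb nc n).Structure N]

section Interpretations

variable (L nb nc n)

noncomputable def numOf (k : ℕ) : N :=
  interp (ar := CodingSymbol.Arity) L (CodingSymbol.num k : CodingSymbol nb nc n) Empty.elim

/-- All added symbols are functions, so the order is given by a characteristic function whose value
`numOf 0` stands for truth. -/
def leOf (x y : N) : Prop :=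
  interp (ar := CodingSymbol.Arity) L (CodingSymbol.le : CodingSymbol nb nc n) ![x, y] =
    numOf L nb nc n 0

noncomputable def infOf : N :=
  interp (ar := CodingSymbol.Arity) L (CodingSymbol.inf : CodingSymbol nb nc n) Empty.elim

noncomputable def bOf (x : N) (j : Fin nb) : N :=
  interp (ar := CodingSymbol.Arity) L (CodingSymbol.B j : CodingSymbol nb nc n) fun _ => x

noncomputable def nodeOf (l : List ℕ) (j : Fin nb) : N :=
  interp (ar := CodingSymbol.Arity) L (CodingSymbol.node l j : CodingSymbol nb nc n) Empty.elim

noncomputable def fOf (i : ℕ) (y : Fin (i + 1) → N) (j : ℕ) : N :=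
  interp (ar := CodingSymbol.Arity) L (CodingSymbol.F i j : CodingSymbol nb nc n) y

noncomputable def gOf (i : ℕ) (x : Fin n → N) (y : Fin i → N) (z : N) : N :=
  interp (ar := CodingSymbol.Arity) L (CodingSymbol.G i : CodingSymbol nb nc n)
    (Sum.elim x (Sum.elim y fun _ => z))

noncomputable def rOf (e : Fin nc → N) (z : N) : N :=
  interp (ar := CodingSymbol.Arity) L (CodingSymbol.R : CodingSymbol nb nc n)
    (Sum.elim e fun _ => z)

noncomputable def decOf (x : Fin n → N) (e : Fin nc → N) (z : N) : N :=
  interp (ar := CodingSymbol.Arity) L (CodingSymbol.dec : CodingSymbol nb nc n)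
    (Sum.elim x (Sum.elim e fun _ => z))

noncomputable def projOf (k : ℕ) (j : Fin k) (y : N) : N :=
  interp (ar := CodingSymbol.Arity) L (CodingSymbol.proj k j : CodingSymbol nb nc n) fun _ => y

end Interpretations

section Terms

variable {α : Type*}

local notation "Tm" => Term (withCoding L nb nc n)

variable (L nb nc n) in
noncomputable def numTm (k : ℕ) : Tm α :=
  app (ar := CodingSymbol.Arity) (CodingSymbol.num k : CodingSymbol nb nc n) Empty.elim

noncomputable def leFm (x y : Tm α) : (L.withCoding nb nc n).Formula α :=
  Term.equal (app (ar := CodingSymbol.Arity) (CodingSymbol.le : CodingSymbol nb nc n) ![x, y])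
    (numTm L nb nc n 0)

variable (L nb nc n) in
noncomputable def infTm : Tm α :=
  app (ar := CodingSymbol.Arity) (CodingSymbol.inf : CodingSymbol nb nc n) Empty.elim

noncomputable def bTm (x : Tm α) (j : Fin nb) : Tm α :=
  app (ar := CodingSymbol.Arity) (CodingSymbol.B j : CodingSymbol nb nc n) fun _ => x

variable (L nb nc n) in
noncomputable def nodeTm (l : List ℕ) (j : Fin nb) : Tm α :=
  app (ar := CodingSymbol.Arity) (CodingSymbol.node l j : CodingSymbol nb nc n) Empty.elim

noncomputable def fTm (i : ℕ) (y : Fin (i + 1) → Tm α) (j : ℕ) : Tm α :=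
  app (ar := CodingSymbol.Arity) (CodingSymbol.F i j : CodingSymbol nb nc n) y

noncomputable def gTm (i : ℕ) (x : Fin n → Tm α) (y : Fin i → Tm α) (z : Tm α) : Tm α :=
  app (ar := CodingSymbol.Arity) (CodingSymbol.G i : CodingSymbol nb nc n)
    (Sum.elim x (Sum.elim y fun _ => z))

noncomputable def rTm (e : Fin nc → Tm α) (z : Tm α) : Tm α :=
  app (ar := CodingSymbol.Arity) (CodingSymbol.R : CodingSymbol nb nc n) (Sum.elim e fun _ => z)

noncomputable def decTm (x : Fin n → Tm α) (e : Fin nc → Tm α) (z : Tm α) : Tm α :=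
  app (ar := CodingSymbol.Arity) (CodingSymbol.dec : CodingSymbol nb nc n)
    (Sum.elim x (Sum.elim e fun _ => z))

noncomputable def projTm (k : ℕ) (j : Fin k) (y : Tm α) : Tm α :=
  app (ar := CodingSymbol.Arity) (CodingSymbol.proj k j : CodingSymbol nb nc n) fun _ => y

variable (w : α → N)

@[simp]
theorem realize_numTm (k : ℕ) : (numTm L nb nc n k).realize w = numOf L nb nc n k := by
  rw [numTm, realize_app, numOf]
  congr 1
  funext a
  exact a.elim

@[simp]
theorem realize_leFm (x y : Tm α) :
    (leFm x y).Realize w ↔ leOf L nb nc n (x.realize w) (y.realize w) := by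
  rw [leFm, Formula.realize_equal, realize_numTm, leOf]
  have : (fun a => (![x, y] a).realize w) = ![x.realize w, y.realize w] := by
    funext a
    fin_cases a <;> rfl
  exact iff_of_eq (congrArg
    (fun z => interp (ar := CodingSymbol.Arity) L CodingSymbol.le z = _) this)

@[simp]
theorem realize_infTm : (infTm L nb nc n).realize w = infOf L nb nc n := by
  rw [infTm, realize_app, infOf]
  congr 1
  funext a
  exact a.elim

@[simp]
theorem realize_bTm (x : Tm α) (j : Fin nb) :
    (bTm x j).realize w = bOf L nb nc n (x.realize w) j := rfl

@[simp]
theorem realize_nodeTm (l : List ℕ) (j : Fin nb) :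
    (nodeTm L nb nc n l j).realize w = nodeOf L nb nc n l j := by
  rw [nodeTm, realize_app, nodeOf]
  congr 1
  funext a
  exact a.elim

@[simp]
theorem realize_fTm (i : ℕ) (y : Fin (i + 1) → Tm α) (j : ℕ) :
    (fTm i y j).realize w = fOf L nb nc n i (fun l => (y l).realize w) j := rfl

@[simp]
theorem realize_gTm (i : ℕ) (x : Fin n → Tm α) (y : Fin i → Tm α) (z : Tm α) :
    (gTm i x y z).realize w = gOf L nb nc n i (fun l => (x l).realize w)
      (fun l => (y l).realize w) (z.realize w) := by
  rw [gTm, realize_app, gOf]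
  congr 1
  funext a
  rcases a with a | a | a <;> rfl

@[simp]
theorem realize_rTm (e : Fin nc → Tm α) (z : Tm α) :
    (rTm e z).realize w = rOf L nb nc n (fun l => (e l).realize w) (z.realize w) := by
  rw [rTm, realize_app, rOf]
  congr 1
  funext a
  rcases a with a | a <;> rfl

@[simp]
theorem realize_decTm (x : Fin n → Tm α) (e : Fin nc → Tm α) (z : Tm α) :
    (decTm x e z).realize w = decOf L nb nc n (fun l => (x l).realize w)
      (fun l => (e l).realize w) (z.realize w) := by
  rw [decTm, realize_app, decOf]
  congr 1
  funext a
  rcases a with a | a | a <;> rfl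

@[simp]
theorem realize_projTm (k : ℕ) (j : Fin k) (y : Tm α) :
    (projTm k j y).realize w = projOf L nb nc n k j (y.realize w) := rfl

end Terms

end Operations

/-! ### Standard expansions of a coding model -/

theorem ofFn_coe_eq_map_range {X : Type*} (f : ℕ → X) (k : ℕ) :
    (List.ofFn fun l : Fin k => f l) = (List.range k).map f := by
  refine List.ext_getElem (by simp) fun i h₁ h₂ => by simp

/-- A model with a tree of instances labelled by its elements and an instance of the order
property along the rationals, together with an enumeration of some of its elements, codes of
finite sequences of its elements and enumerations of the labels of consistent siblings. -/
structure CodingModel (L : Language.{u, v}) (M : Type w) [L.Structure M] where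
  n : ℕ
  σ : ℕ → LevelData L n
  F : List M → ℕ → M
  isInstanceTree : IsInstanceTree σ F
  (nb nc : ℕ)
  φ : L.Formula (Fin nb ⊕ Fin nc)
  b : ℚ → Fin nb → M
  c : ℚ → Fin nc → M
  ordersBy : OrdersBy φ b c
  num : ℕ → M
  toNat : M → ℕ
  toNat_num : ∀ k, toNat (num k) = k
  proj : ∀ k, M → Fin k → M
  proj_surjective : ∀ k, Function.Surjective (proj k)
  sibling : ∀ i, (Fin n → M) → (Fin i → M) → ℕ → M
  exists_sibling : ∀ i x y a,
    (σ i).formula.Realize (Sum.elim x fun j => F (List.ofFn y ++ [a]) j) →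
    ∃ j < (σ i).k, a = sibling i x y j

/-- The order along `ℚ` makes `M` infinite, which gives the numerals and, by cardinal arithmetic,
surjections of `M` onto its finite powers. By `k`-inconsistency, one tuple satisfies the instances
of fewer than `k` siblings, so their labels can be listed in advance. -/
theorem CodingModel.exists_of_ordersBy {L : Language.{u, v}} {M : Type w} [L.Structure M]
    [Nonempty M] {n : ℕ} {σ : ℕ → LevelData L n} {F : List M → ℕ → M} (hF : IsInstanceTree σ F)
    {nb nc : ℕ} {φ : L.Formula (Fin nb ⊕ Fin nc)} {b : ℚ → Fin nb → M} {c : ℚ → Fin nc → M}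
    (hφ : OrdersBy φ b c) : Nonempty (CodingModel L M) := by
  classical
  have hb : Function.Injective b := by
    intro q r hqr
    by_contra hne
    rcases lt_or_gt_of_ne hne with h | h
    · have := (hφ q r).2 h
      rw [hqr, hφ] at this
      exact lt_irrefl _ this
    · have := (hφ r q).2 h
      rw [← hqr, hφ] at this
      exact lt_irrefl _ this
  have hinf : Infinite M := by
    by_contra hfin
    rw [not_infinite_iff_finite] at hfin
    exact Infinite.not_finite (Finite.of_injective b hb)
  have hproj : ∀ k, ∃ f : M → Fin k → M, Function.Surjective f := by
    intro k
    have : #(Fin k → M) ≤ #M := by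
      rw [mk_arrow]
      simpa using power_nat_le (n := k) (infinite_iff.1 hinf)
    obtain ⟨g⟩ := this
    exact ⟨Function.invFun g, Function.invFun_surjective g.injective⟩
  choose proj hproj using hproj
  have hsib : ∀ i (x : Fin n → M) (η : List M), η.length = i → ∃ g : ℕ → M, ∀ a,
      (σ i).formula.Realize (Sum.elim x fun j => F (η ++ [a]) j) → ∃ j < (σ i).k, a = g j := by
    rintro i x η rfl
    let C : Set M := {a | (σ η.length).formula.Realize (Sum.elim x fun j => F (η ++ [a]) j)}
    have hno : ∀ J : Finset M, (J : Set M) ⊆ C → J.card ≠ (σ η.length).k :=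
      fun J hJ hc => hF.inconsistent η J hc ⟨x, fun a ha => hJ ha⟩
    have hfin : C.Finite := by
      by_contra hC
      obtain ⟨J, hJ, hc⟩ := Set.Infinite.exists_subset_card_eq hC (σ η.length).k
      exact hno J hJ hc
    have hlt : hfin.toFinset.card < (σ η.length).k := by
      by_contra! hle
      obtain ⟨J, hJ, hc⟩ := Finset.exists_subset_card_eq hle
      exact hno J (fun a ha => by simpa using hJ ha) hc
    refine ⟨fun j => if h : j < hfin.toFinset.card then hfin.toFinset.equivFin.symm ⟨j, h⟩
      else Classical.arbitrary M, fun a ha => ?_⟩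
    have ha' : a ∈ hfin.toFinset := hfin.mem_toFinset.2 ha
    refine ⟨hfin.toFinset.equivFin ⟨a, ha'⟩, (Fin.is_lt _).trans hlt, ?_⟩
    simp
  choose sib hsib using fun i (x : Fin n → M) (y : Fin i → M) => hsib i x (List.ofFn y) (by simp)
  let num := Infinite.natEmbedding M
  exact ⟨⟨n, σ, F, hF, nb, nc, φ, b, c, hφ, num, Function.invFun num,
    Function.leftInverse_invFun num.injective, proj, hproj, sib, hsib⟩⟩

namespace CodingModel

variable {L : Language.{u, v}} {M : Type w} [L.Structure M] (D : CodingModel L M)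

/-- The path of natural numbers determined by the cut of a tuple. -/
noncomputable def path (e : Fin D.nc → M) : ℕ → ℕ :=
  courseOfValues fun _ f =>
    sInf {j | D.φ.Realize (Sum.elim (D.b (treePos (List.ofFn f ++ [j]))) e)}

/-- The sequence decoded from a pair of tuples. -/
noncomputable def decode (x : Fin D.n → M) (e : Fin D.nc → M) : ℕ → M :=
  courseOfValues fun i f => D.sibling i x f (D.path e i)

open Classical in
/-- The interpretation of the coding symbols, with `t` as the distinguished number. -/
noncomputable def interpretation (t : ℕ) :
    ∀ s : CodingSymbol D.nb D.nc D.n, (s.Arity → M) → M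
  | .num k, _ => D.num k
  | .le, x => if ∃ i j, i ≤ j ∧ x 0 = D.num i ∧ x 1 = D.num j then D.num 0 else D.num 1
  | .inf, _ => D.num t
  | .B j, x => D.b (D.toNat (x ())) j
  | .node l j, _ => D.b (treePos l) j
  | .F _ j, y => D.F (List.ofFn y) j
  | .G i, x => D.sibling i (fun l => x (.inl l)) (fun l => x (.inr (.inl l)))
      (D.toNat (x (.inr (.inr ()))))
  | .R, x => D.num (D.path (fun l => x (.inl l)) (D.toNat (x (.inr ()))))
  | .dec, x => D.decode (fun l => x (.inl l)) (fun l => x (.inr (.inl l)))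
      (D.toNat (x (.inr (.inr ()))))
  | .proj k j, x => D.proj k (x ()) j

/-- The model expanded by the interpretation of the coding symbols. -/
def Expanded (_ : CodingModel L M) (_ : ℕ) : Type w := M

variable (t : ℕ)

instance : L.Structure (D.Expanded t) := inferInstanceAs (L.Structure M)

noncomputable instance : (functionLanguage.{u, v}
    (CodingSymbol.Arity : CodingSymbol D.nb D.nc D.n → Type)).Structure (D.Expanded t) :=
  functionStructure (D.interpretation t)

instance [h : Nonempty M] : Nonempty (D.Expanded t) := h

variable {t}

theorem interp_eq (s : CodingSymbol D.nb D.nc D.n) (x : s.Arity → D.Expanded t) :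
    interp (ar := CodingSymbol.Arity) L s x = D.interpretation t s x :=
  interp_functionStructure (D.interpretation t) s x

theorem num_injective : Function.Injective D.num :=
  Function.LeftInverse.injective D.toNat_num

theorem numOf_eq (k : ℕ) : (numOf L D.nb D.nc D.n k : D.Expanded t) = D.num k :=
  D.interp_eq _ _

theorem leOf_iff (x y : D.Expanded t) : leOf L D.nb D.nc D.n x y ↔
    ∃ i j, i ≤ j ∧ x = D.num i ∧ y = D.num j := by
  rw [leOf, numOf_eq, interp_eq]
  simp only [interpretation]
  split_ifs with h
  · exact iff_of_true rfl h
  · exact iff_of_false (fun h' => absurd (D.num_injective h') one_ne_zero) h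

theorem infOf_eq : (infOf L D.nb D.nc D.n : D.Expanded t) = D.num t :=
  D.interp_eq _ _

theorem bOf_eq (x : D.Expanded t) : bOf L D.nb D.nc D.n x = D.b (D.toNat x) :=
  funext fun _ => D.interp_eq _ _

theorem nodeOf_eq (l : List ℕ) :
    (nodeOf L D.nb D.nc D.n l : _ → D.Expanded t) = D.b (treePos l) :=
  funext fun _ => D.interp_eq _ _

theorem fOf_eq (i : ℕ) (y : Fin (i + 1) → D.Expanded t) :
    fOf L D.nb D.nc D.n i y = D.F (List.ofFn y) :=
  funext fun _ => D.interp_eq _ _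

theorem gOf_eq (i : ℕ) (x : Fin D.n → D.Expanded t) (y : Fin i → D.Expanded t)
    (z : D.Expanded t) : gOf L D.nb D.nc D.n i x y z = D.sibling i x y (D.toNat z) :=
  D.interp_eq _ _

theorem rOf_eq (e : Fin D.nc → D.Expanded t) (z : D.Expanded t) :
    rOf L D.nb D.nc D.n e z = D.num (D.path e (D.toNat z)) :=
  D.interp_eq _ _

theorem decOf_eq (x : Fin D.n → D.Expanded t) (e : Fin D.nc → D.Expanded t)
    (z : D.Expanded t) : decOf L D.nb D.nc D.n x e z = D.decode x e (D.toNat z) :=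
  D.interp_eq _ _

theorem projOf_eq (k : ℕ) (j : Fin k) (y : D.Expanded t) :
    projOf L D.nb D.nc D.n k j y = D.proj k y j :=
  D.interp_eq _ _

theorem exists_path (f : ℕ → ℕ) (k : ℕ) : ∃ e, ∀ i < k,
    D.φ.Realize (Sum.elim (D.b (treePos ((List.range i).map f ++ [f i]))) e) ∧
    ∀ j < f i, ¬ D.φ.Realize (Sum.elim (D.b (treePos ((List.range i).map f ++ [j]))) e) := by
  -- One entry more than the `k` that are checked, so that every prefix involved is proper and lies
  -- strictly below the cut.
  refine ⟨D.c (treePos ((List.range (k + 1)).map f)), fun i hi => ?_⟩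
  obtain ⟨m, rfl⟩ := Nat.exists_eq_add_of_lt hi
  have : (List.range (i + m + 1 + 1)).map f = (List.range i).map f ++
      f i :: (List.range (m + 1)).map (fun l => f (i + (l + 1))) := by
    rw [show i + m + 1 + 1 = i + (m + 1 + 1) by omega, List.range_add, List.map_append,
      List.range_succ_eq_map (n := m + 1)]
    simp [Function.comp_def]
  rw [this]
  refine ⟨(D.ordersBy _ _).2 (treePos_lt_of_prefix _ _ (by simp)), fun j hj h => ?_⟩
  exact absurd ((D.ordersBy _ _).1 h) (not_lt.2 (treePos_le_of_lt _ hj _))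

theorem path_eq (f : ℕ → ℕ) (k : ℕ) (e : Fin D.nc → M) (h : ∀ i ≤ k,
    D.φ.Realize (Sum.elim (D.b (treePos ((List.range i).map f ++ [f i]))) e) ∧
    ∀ j < f i, ¬ D.φ.Realize (Sum.elim (D.b (treePos ((List.range i).map f ++ [j]))) e)) :
    D.path e k = f k := by
  induction k using Nat.strong_induction_on with
  | _ k ih =>
    have hp : (List.ofFn fun l : Fin k => D.path e l) = (List.range k).map f := by
      rw [ofFn_coe_eq_map_range]
      exact List.map_congr_left fun i hi => ih i (List.mem_range.1 hi) fun j hj =>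
        h j (hj.trans (List.mem_range.1 hi).le)
    rw [path, courseOfValues_eq]
    change sInf {j | D.φ.Realize (Sum.elim
      (D.b (treePos ((List.ofFn fun l : Fin k => D.path e l) ++ [j]))) e)} = f k
    rw [hp]
    refine IsLeast.csInf_eq ⟨(h k le_rfl).1, fun j hj => ?_⟩
    by_contra! hlt
    exact (h k le_rfl).2 j hlt hj

theorem decode_eq (x : Fin D.n → M) (e : Fin D.nc → M) (i : ℕ) :
    D.decode x e i = D.sibling i x (fun j => D.decode x e j) (D.path e i) := by
  rw [decode, courseOfValues_eq]

theorem exists_branch (k : ℕ) (y : ℕ → M) : ∃ x, ∀ i < k, (D.σ i).formula.Realize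
    (Sum.elim x fun j => D.F (List.ofFn fun l : Fin (i + 1) => y l) j) := by
  obtain ⟨x, hx⟩ := D.isInstanceTree.consistent ((List.range k).map y)
  refine ⟨x, fun i hi => ?_⟩
  have := hx ⟨i, by simpa using hi⟩
  rw [← List.map_take, List.take_range, min_eq_left (by simpa using hi)] at this
  rw [ofFn_coe_eq_map_range]
  exact this

theorem exists_eq_sibling (i : ℕ) (x : Fin D.n → M) (y : ℕ → M)
    (h : (D.σ i).formula.Realize
      (Sum.elim x fun j => D.F (List.ofFn fun l : Fin (i + 1) => y l) j)) :
    ∃ j < (D.σ i).k, y i = D.sibling i x (fun l => y l) j := by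
  refine D.exists_sibling i x (fun l => y l) (y i) ?_
  rw [ofFn_coe_eq_map_range, List.range_succ, List.map_append] at h
  rw [ofFn_coe_eq_map_range]
  exact h

end CodingModel

/-! ### Tools for writing the coding axioms as formulas -/

section Quantifiers

variable {L : Language.{u, v}} {α N : Type*} [L.Structure N]

/-- Existential quantification over one variable. -/
noncomputable def Formula.exOne (φ : L.Formula (α ⊕ Unit)) : L.Formula α := φ.iExs Unit

/-- Universal quantification over one variable. -/
noncomputable def Formula.allOne (φ : L.Formula (α ⊕ Unit)) : L.Formula α := φ.iAlls Unit

@[simp]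
theorem Formula.realize_exOne (φ : L.Formula (α ⊕ Unit)) (y : α → N) :
    φ.exOne.Realize y ↔ ∃ a, φ.Realize (Sum.elim y fun _ => a) := by
  rw [Formula.exOne, Formula.realize_iExs]
  exact ⟨fun ⟨i, hi⟩ => ⟨i (), hi⟩, fun ⟨a, ha⟩ => ⟨_, ha⟩⟩

@[simp]
theorem Formula.realize_allOne (φ : L.Formula (α ⊕ Unit)) (y : α → N) :
    φ.allOne.Realize y ↔ ∀ a, φ.Realize (Sum.elim y fun _ => a) := by
  rw [Formula.allOne, Formula.realize_iAlls]
  exact ⟨fun h a => h fun _ => a, fun h i => h (i ())⟩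

end Quantifiers

section AtTerms

variable {L : Language.{u, v}} {S : Type} {ar : S → Type} [∀ s, Fintype (ar s)] {α : Type*}
  {p q : ℕ}

/-- The instance of a formula in two tuples of variables at terms of an expansion. -/
noncomputable def Formula.atPair (χ : L.Formula (Fin p ⊕ Fin q))
    (f : Fin p → (L.withFunctions ar).Term α) (g : Fin q → (L.withFunctions ar).Term α) :
    (L.withFunctions ar).Formula α :=
  χ.atTerms ar (Sum.elim f g)

@[simp]
theorem Formula.realize_atPair (χ : L.Formula (Fin p ⊕ Fin q))
    (f : Fin p → (L.withFunctions ar).Term α) (g : Fin q → (L.withFunctions ar).Term α)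
    {N : Type*} [L.Structure N] [(L.withFunctions ar).Structure N]
    [(LHom.sumInl : L →ᴸ L.withFunctions ar).IsExpansionOn N] (y : α → N) :
    (χ.atPair f g).Realize y ↔
      χ.Realize (Sum.elim (fun j => (f j).realize y) fun j => (g j).realize y) := by
  rw [Formula.atPair, Formula.realize_atTerms]
  exact iff_of_eq (congrArg _ (funext fun a => by cases a <;> rfl))

end AtTerms

/-! ### Transfer of the coding axioms -/

namespace CodingModel

variable {L : Language.{u, v}} {M₀ : Type u'} [L.Structure M₀] (D : CodingModel L M₀)

/-- `M` satisfies all universal closures of formulas that hold in all expansions of a coding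
model. -/
def Transfers (M : Type v') [(L.withCoding D.nb D.nc D.n).Structure M] : Prop :=
  ∀ {α : Type} (ψ : (L.withCoding D.nb D.nc D.n).Formula α),
    (∀ (t : ℕ) (y : α → D.Expanded t), ψ.Realize y) → ∀ y : α → M, ψ.Realize y

variable {D} {M : Type v'} [(L.withCoding D.nb D.nc D.n).Structure M]

local notation "vr" => Term.var

variable (D) in
/-- The formula saying that the first `k` values of the path of `e` agree with `f`. -/
noncomputable def pathFm {α : Type} (f : ℕ → ℕ) (k : ℕ)
    (e : Fin D.nc → (L.withCoding D.nb D.nc D.n).Term α) :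
    (L.withCoding D.nb D.nc D.n).Formula α :=
  Formula.iInf fun i : Fin k =>
    D.φ.atPair (nodeTm L D.nb D.nc D.n ((List.range i).map f ++ [f i])) e ⊓
      Formula.iInf fun j : Fin (f i) =>
        (D.φ.atPair (nodeTm L D.nb D.nc D.n ((List.range i).map f ++ [(j : ℕ)])) e).not

theorem realize_pathFm [L.Structure M]
    [(LHom.sumInl : L →ᴸ L.withCoding D.nb D.nc D.n).IsExpansionOn M] {α : Type} (f : ℕ → ℕ)
    (k : ℕ) (e : Fin D.nc → (L.withCoding D.nb D.nc D.n).Term α) (y : α → M) :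
    (D.pathFm f k e).Realize y ↔ ∀ i < k,
      D.φ.Realize (Sum.elim (nodeOf L D.nb D.nc D.n ((List.range i).map f ++ [f i]))
        fun j => (e j).realize y) ∧
      ∀ j < f i, ¬ D.φ.Realize (Sum.elim
        (nodeOf L D.nb D.nc D.n ((List.range i).map f ++ [j])) fun j => (e j).realize y) := by
  simp only [pathFm, Formula.realize_iInf, Formula.realize_inf, Formula.realize_not,
    Formula.realize_atPair, realize_nodeTm, Fin.forall_iff]

namespace Transfers

theorem num_injective (tr : D.Transfers M) :
    Function.Injective (numOf L D.nb D.nc D.n : ℕ → M) := by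
  intro k l h
  by_contra hne
  have := tr (α := Empty) (Term.equal (numTm L D.nb D.nc D.n k) (numTm L D.nb D.nc D.n l)).not
    (fun t y => by
      simp only [Formula.realize_not, Formula.realize_equal, realize_numTm, numOf_eq]
      exact fun h => hne (D.num_injective h)) Empty.elim
  simp [h] at this

/-- For fixed `k` the right-hand side is a finite disjunction, hence first-order: no nonstandard
element appears below a standard one. -/
theorem le_num_iff (tr : D.Transfers M) (x : M) (k : ℕ) :
    leOf L D.nb D.nc D.n x (numOf L D.nb D.nc D.n k) ↔
    ∃ j ≤ k, x = numOf L D.nb D.nc D.n j := by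
  have := tr (α := Unit) ((leFm (vr ()) (numTm L D.nb D.nc D.n k)).iff
    (Formula.iSup fun j : Fin (k + 1) => Term.equal (vr ()) (numTm L D.nb D.nc D.n j)))
    (fun t y => by
      simp only [Formula.realize_iff, realize_leFm, Term.realize_var, realize_numTm,
        Formula.realize_iSup, Formula.realize_equal, leOf_iff]
      simp only [numOf_eq]
      constructor
      · rintro ⟨i, j, hij, hi, hj⟩
        obtain rfl := D.num_injective hj
        exact ⟨⟨i, by omega⟩, hi⟩
      · rintro ⟨j, hj⟩
        exact ⟨j, k, by omega, hj, rfl⟩) (fun _ => x)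
  simp only [Formula.realize_iff, realize_leFm, Term.realize_var, realize_numTm,
        Formula.realize_iSup, Formula.realize_equal] at this
  rw [this]
  exact ⟨fun ⟨j, hj⟩ => ⟨j, by omega, hj⟩, fun ⟨j, hj, h⟩ => ⟨⟨j, by omega⟩, h⟩⟩

theorem le_left (tr : D.Transfers M) (x y : M) :
    leOf L D.nb D.nc D.n x y → leOf L D.nb D.nc D.n x x := by
  have := tr (α := Fin 2) ((leFm (vr 0) (vr 1)).imp (leFm (vr 0) (vr 0))) (fun t y => by
    simp only [Formula.realize_imp, realize_leFm, Term.realize_var, leOf_iff]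
    rintro ⟨i, j, hij, hi, hj⟩
    exact ⟨i, i, le_rfl, hi, hi⟩) ![x, y]
  simpa using this

theorem le_right (tr : D.Transfers M) (x y : M) :
    leOf L D.nb D.nc D.n x y → leOf L D.nb D.nc D.n y y := by
  have := tr (α := Fin 2) ((leFm (vr 0) (vr 1)).imp (leFm (vr 1) (vr 1))) (fun t y => by
    simp only [Formula.realize_imp, realize_leFm, Term.realize_var, leOf_iff]
    rintro ⟨i, j, hij, hi, hj⟩
    exact ⟨j, j, le_rfl, hj, hj⟩) ![x, y]
  simpa using this

theorem le_total (tr : D.Transfers M) (x y : M) :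
    leOf L D.nb D.nc D.n x x → leOf L D.nb D.nc D.n y y →
    leOf L D.nb D.nc D.n x y ∨ leOf L D.nb D.nc D.n y x := by
  have := tr (α := Fin 2) ((leFm (vr 0) (vr 0)).imp ((leFm (vr 1) (vr 1)).imp
    (leFm (vr 0) (vr 1) ⊔ leFm (vr 1) (vr 0)))) (fun t y => by
    simp only [Formula.realize_imp, Formula.realize_sup, realize_leFm, Term.realize_var, leOf_iff]
    rintro ⟨i, -, -, hi, -⟩ ⟨j, -, -, hj, -⟩
    rcases Nat.le_total i j with h | h
    · exact Or.inl ⟨i, j, h, hi, hj⟩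
    · exact Or.inr ⟨j, i, h, hj, hi⟩) ![x, y]
  simpa using this

theorem le_antisymm (tr : D.Transfers M) (x y : M) :
    leOf L D.nb D.nc D.n x y → leOf L D.nb D.nc D.n y x →
    x = y := by
  have := tr (α := Fin 2) ((leFm (vr 0) (vr 1)).imp ((leFm (vr 1) (vr 0)).imp
    (Term.equal (vr 0) (vr 1)))) (fun t y => by
    simp only [Formula.realize_imp, Formula.realize_equal, realize_leFm, Term.realize_var,
      leOf_iff]
    rintro ⟨i, j, hij, hi, hj⟩ ⟨j', i', hij', hj', hi'⟩
    obtain rfl := D.num_injective (hi.symm.trans hi')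
    obtain rfl := D.num_injective (hj.symm.trans hj')
    rw [hi, hj, Nat.le_antisymm hij hij']) ![x, y]
  simpa using this

theorem le_trans (tr : D.Transfers M) (x y z : M) :
    leOf L D.nb D.nc D.n x y → leOf L D.nb D.nc D.n y z →
    leOf L D.nb D.nc D.n x z := by
  have := tr (α := Fin 3) ((leFm (vr 0) (vr 1)).imp ((leFm (vr 1) (vr 2)).imp
    (leFm (vr 0) (vr 2)))) (fun t y => by
    simp only [Formula.realize_imp, realize_leFm, Term.realize_var, leOf_iff]
    rintro ⟨i, j, hij, hi, hj⟩ ⟨j', k, hjk, hj', hk⟩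
    obtain rfl := D.num_injective (hj.symm.trans hj')
    exact ⟨i, k, hij.trans hjk, hi, hk⟩) ![x, y, z]
  simpa using this

theorem le_inf (tr : D.Transfers M) :
    leOf L D.nb D.nc D.n (infOf L D.nb D.nc D.n : M) (infOf L D.nb D.nc D.n) := by
  have := tr (α := Empty) (leFm (infTm L D.nb D.nc D.n) (infTm L D.nb D.nc D.n)) (fun t y => by
    simp only [realize_leFm, realize_infTm, leOf_iff]
    simp only [infOf_eq]
    exact ⟨t, t, le_rfl, rfl, rfl⟩) Empty.elim
  simpa using this

theorem exists_pred (tr : D.Transfers M) (x : M) :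
    leOf L D.nb D.nc D.n x x → x = numOf L D.nb D.nc D.n 0 ∨
    ∃ y, leOf L D.nb D.nc D.n y x ∧ y ≠ x ∧
      ∀ z, leOf L D.nb D.nc D.n z x → z ≠ x → leOf L D.nb D.nc D.n z y := by
  have := tr (α := Unit) ((leFm (vr ()) (vr ())).imp
    ((Term.equal (vr ()) (numTm L D.nb D.nc D.n 0)) ⊔
      (leFm (vr (.inr ())) (vr (.inl ())) ⊓ ((Term.equal (vr (.inr ())) (vr (.inl ()))).not ⊓
        ((leFm (vr (.inr ())) (vr (.inl (.inl ())))).imp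
          ((Term.equal (vr (.inr ())) (vr (.inl (.inl ())))).not.imp
            (leFm (vr (.inr ())) (vr (.inl (.inr ())))))).allOne)).exOne)) (fun t y => by
    simp only [Formula.realize_imp, Formula.realize_sup, Formula.realize_inf, Formula.realize_not,
      Formula.realize_equal, realize_leFm, Term.realize_var, leOf_iff, Formula.realize_exOne,
      Formula.realize_allOne, realize_numTm, numOf_eq, Sum.elim_inl, Sum.elim_inr]
    rintro ⟨i, -, -, hi, -⟩
    rw [hi]
    cases i with
    | zero => exact Or.inl rfl
    | succ i =>
      refine Or.inr ⟨D.num i, ⟨i, i + 1, by omega, rfl, rfl⟩, fun h => ?_, ?_⟩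
      · exact absurd (D.num_injective h) (by omega)
      · rintro z ⟨l, m, hlm, rfl, hm⟩ hne
        obtain rfl := D.num_injective hm
        refine ⟨l, i, ?_, rfl, rfl⟩
        have : l ≠ i + 1 := by rintro rfl; exact hne rfl
        omega) fun _ => x
  simpa using this

/-- The least number principle. -/
theorem exists_least (tr : D.Transfers M) {β : Type}
    (P : (L.withCoding D.nb D.nc D.n).Formula (β ⊕ Unit)) (y : β → M)
    (i₀ i : M) (h₀ : leOf L D.nb D.nc D.n i₀ i) (hi : P.Realize (Sum.elim y fun _ => i)) :
    ∃ h, leOf L D.nb D.nc D.n i₀ h ∧ P.Realize (Sum.elim y fun _ => h) ∧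
      ∀ l, leOf L D.nb D.nc D.n i₀ l → leOf L D.nb D.nc D.n l h → l ≠ h →
        ¬ P.Realize (Sum.elim y fun _ => l) := by
  have := tr (α := β ⊕ Fin 2) ((leFm (vr (.inr 0)) (vr (.inr 1))).imp
    ((P.relabel (Sum.map id fun _ => (1 : Fin 2))).imp
      (leFm (vr (.inl (.inr 0))) (vr (.inr ())) ⊓ (P.relabel (Sum.map Sum.inl id) ⊓
        ((leFm (vr (.inl (.inl (.inr 0)))) (vr (.inr ()))).imp
          ((leFm (vr (.inr ())) (vr (.inl (.inr ())))).imp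
            ((Term.equal (vr (.inr ())) (vr (.inl (.inr ())))).not.imp
              (P.relabel (Sum.map (fun b => Sum.inl (Sum.inl b)) id)).not))).allOne)).exOne))
    (fun t y => by
      simp only [Formula.realize_imp, Formula.realize_inf, Formula.realize_not,
        Formula.realize_equal, realize_leFm, Term.realize_var, leOf_iff, Formula.realize_exOne,
        Formula.realize_allOne, Formula.realize_relabel, Sum.elim_comp_map, Sum.elim_inl,
        Sum.elim_inr]
      rintro ⟨a, k, hak, ha, hk⟩ hP
      classical
      -- In a standard expansion the numbers are exactly the numerals, so a least witness from `a`
      -- on is found in `ℕ`, whatever formula `P` of the expanded language is given.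
      let Q : ℕ → Prop := fun l => a ≤ l ∧ P.Realize (Sum.elim (y ∘ Sum.inl)
        fun _ => (D.num l : D.Expanded t))
      have hQ : ∃ l, Q l := ⟨k, hak, by
        rw [← hk]
        convert hP using 1
        funext b
        cases b <;> rfl⟩
      refine ⟨D.num (Nat.find hQ), ⟨a, _, (Nat.find_spec hQ).1, ha, rfl⟩,
        (Nat.find_spec hQ).2, ?_⟩
      rintro _ ⟨a', l, hal, ha', rfl⟩ ⟨l', m, hlm, hl', hm⟩ hne hPl
      obtain rfl := D.num_injective (ha.symm.trans ha')
      obtain rfl := D.num_injective hl'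
      obtain rfl := D.num_injective hm
      exact Nat.find_min hQ (lt_of_le_of_ne hlm fun he => hne (he ▸ rfl)) ⟨hal, hPl⟩)
    (Sum.elim y ![i₀, i])
  simp only [Formula.realize_imp, Formula.realize_inf, Formula.realize_not,
    Formula.realize_equal, realize_leFm, Term.realize_var, Formula.realize_exOne,
    Formula.realize_allOne, Formula.realize_relabel, Sum.elim_comp_map, Sum.elim_inl,
    Sum.elim_inr] at this
  refine this h₀ ?_
  convert hi using 1
  funext b
  cases b <;> rfl

theorem decOf_numOf (tr : D.Transfers M) (x : Fin D.n → M) (e : Fin D.nc → M) (i : ℕ) :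
    decOf L D.nb D.nc D.n x e (numOf L D.nb D.nc D.n i) =
      gOf L D.nb D.nc D.n i x
        (fun j : Fin i => decOf L D.nb D.nc D.n x e (numOf L D.nb D.nc D.n j))
        (rOf L D.nb D.nc D.n e (numOf L D.nb D.nc D.n i)) := by
  have := tr (α := Fin D.n ⊕ Fin D.nc) (Term.equal
    (decTm (fun l => vr (.inl l)) (fun l => vr (.inr l)) (numTm L D.nb D.nc D.n i))
    (gTm i (fun l => vr (.inl l)) (fun j : Fin i =>
      decTm (fun l => vr (.inl l)) (fun l => vr (.inr l)) (numTm L D.nb D.nc D.n j))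
      (rTm (fun l => vr (.inr l)) (numTm L D.nb D.nc D.n i))))
    (fun t y => by
      simp only [Formula.realize_equal, realize_decTm, realize_gTm, realize_rTm, realize_numTm,
        Term.realize_var]
      rw [gOf_eq, rOf_eq]
      simp only [decOf_eq]
      simp only [numOf_eq, D.toNat_num]
      exact D.decode_eq _ _ _) (Sum.elim x e)
  simpa only [Formula.realize_equal, realize_decTm, realize_gTm, realize_rTm, realize_numTm,
    Term.realize_var, Sum.elim_inl, Sum.elim_inr] using this

theorem exists_projOf (tr : D.Transfers M) (k : ℕ) (x : Fin k → M) :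
    ∃ y, ∀ i, projOf L D.nb D.nc D.n k i y = x i := by
  have := tr (α := Fin k) (Formula.exOne (Formula.iInf fun i : Fin k =>
    Term.equal (projTm (nb := D.nb) (nc := D.nc) (n := D.n) k i (vr (.inr ()))) (vr (.inl i))))
    (fun t y => by
      simp only [Formula.realize_exOne, Formula.realize_iInf, Formula.realize_equal,
        realize_projTm, Term.realize_var, Sum.elim_inl, Sum.elim_inr, projOf_eq]
      obtain ⟨a, ha⟩ := D.proj_surjective k y
      exact ⟨a, fun i => congrFun ha i⟩) x
  simpa only [Formula.realize_exOne, Formula.realize_iInf, Formula.realize_equal,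
    realize_projTm, Term.realize_var, Sum.elim_inl, Sum.elim_inr] using this

variable [L.Structure M] [(LHom.sumInl : L →ᴸ L.withCoding D.nb D.nc D.n).IsExpansionOn M]

theorem order (tr : D.Transfers M) (h : M) :
    leOf L D.nb D.nc D.n h h → ∃ y, ∀ i, leOf L D.nb D.nc D.n i i →
    (D.φ.Realize (Sum.elim (bOf L D.nb D.nc D.n i) y) ↔ leOf L D.nb D.nc D.n i h ∧ i ≠ h) := by
  have := tr (α := Unit) ((leFm (vr ()) (vr ())).imp (Formula.iExs (Fin D.nc) (Formula.allOne
    ((leFm (vr (.inr ())) (vr (.inr ()))).imp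
      ((D.φ.atPair (bTm (vr (.inr ()))) (fun j => vr (.inl (.inr j)))).iff
        (leFm (vr (.inr ())) (vr (.inl (.inl ()))) ⊓
          (Term.equal (vr (.inr ())) (vr (.inl (.inl ())))).not))))))
    (fun t y => by
      simp only [Formula.realize_imp, Formula.realize_inf, Formula.realize_not,
        Formula.realize_equal, realize_leFm, Term.realize_var, leOf_iff, Formula.realize_iExs,
        Formula.realize_allOne, Formula.realize_iff, Formula.realize_atPair, realize_bTm,
        Sum.elim_inl, Sum.elim_inr, bOf_eq]
      rintro ⟨k, -, -, hk, -⟩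
      refine ⟨D.c k, ?_⟩
      rintro a ⟨i, -, -, rfl, -⟩
      rw [hk, D.toNat_num]
      refine (D.ordersBy _ _).trans ?_
      rw [Nat.cast_lt]
      constructor
      · exact fun h => ⟨⟨i, k, h.le, rfl, rfl⟩, fun he => h.ne (D.num_injective he)⟩
      · rintro ⟨⟨i', k', hle, hi', hk'⟩, hne⟩
        obtain rfl := D.num_injective hi'
        obtain rfl := D.num_injective hk'
        exact lt_of_le_of_ne hle fun he => hne (he ▸ rfl)) fun _ => h
  simpa using this

theorem order_least (tr : D.Transfers M) (y : Fin D.nc → M) (i : M) (hi : leOf L D.nb D.nc D.n i i)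
    (h : ¬ D.φ.Realize (Sum.elim (bOf L D.nb D.nc D.n i) y)) : ∃ j, leOf L D.nb D.nc D.n j j ∧
      ¬ D.φ.Realize (Sum.elim (bOf L D.nb D.nc D.n j) y) ∧
      ∀ l, leOf L D.nb D.nc D.n l j → l ≠ j →
        D.φ.Realize (Sum.elim (bOf L D.nb D.nc D.n l) y) := by
  -- Zero is the least number, so starting `exists_least` there removes the lower bound.
  have h0 : ∀ x : M, leOf L D.nb D.nc D.n x x →
      leOf L D.nb D.nc D.n (numOf L D.nb D.nc D.n 0) x := fun x hx => by
    rcases tr.le_total _ x ((tr.le_num_iff _ 0).2 ⟨0, le_rfl, rfl⟩) hx with h | h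
    · exact h
    · obtain ⟨j, hj, rfl⟩ := (tr.le_num_iff _ _).1 h
      rwa [Nat.le_zero.1 hj] at hx ⊢
  have hP : ∀ x : M, ((D.φ.atPair (bTm (vr (.inr ()))) (fun j => vr (.inl j))).not :
      (L.withCoding D.nb D.nc D.n).Formula (Fin D.nc ⊕ Unit)).Realize (Sum.elim y fun _ => x) ↔
        ¬ D.φ.Realize (Sum.elim (bOf L D.nb D.nc D.n x) y) := fun x => by
    rw [Formula.realize_not, Formula.realize_atPair]
    rfl
  obtain ⟨j, hj, hj', hl⟩ := tr.exists_least _ y _ i (h0 i hi) ((hP i).2 h)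
  refine ⟨j, tr.le_right _ _ hj, (hP j).1 hj', fun l hlj hne => ?_⟩
  have := hl l (h0 l (tr.le_left _ _ hlj)) hlj hne
  rwa [hP, not_not] at this

theorem exists_path (tr : D.Transfers M) (f : ℕ → ℕ) (k : ℕ) : ∃ e : Fin D.nc → M, ∀ i < k,
    D.φ.Realize (Sum.elim (nodeOf L D.nb D.nc D.n ((List.range i).map f ++ [f i])) e) ∧
    ∀ j < f i,
      ¬ D.φ.Realize (Sum.elim (nodeOf L D.nb D.nc D.n ((List.range i).map f ++ [j])) e) := by
  have := tr (α := Empty) (Formula.iExs (Fin D.nc) (D.pathFm f k fun j => vr (.inr j)))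
    (fun t y => by
      simp only [Formula.realize_iExs, realize_pathFm, Term.realize_var, Sum.elim_inr, nodeOf_eq]
      exact D.exists_path f k) Empty.elim
  simpa only [Formula.realize_iExs, realize_pathFm, Term.realize_var, Sum.elim_inr] using this

theorem rOf_numOf (tr : D.Transfers M) (f : ℕ → ℕ) (k : ℕ) (e : Fin D.nc → M) (h : ∀ i ≤ k,
    D.φ.Realize (Sum.elim (nodeOf L D.nb D.nc D.n ((List.range i).map f ++ [f i])) e) ∧
    ∀ j < f i,
      ¬ D.φ.Realize (Sum.elim (nodeOf L D.nb D.nc D.n ((List.range i).map f ++ [j])) e)) :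
    rOf L D.nb D.nc D.n e (numOf L D.nb D.nc D.n k) = numOf L D.nb D.nc D.n (f k) := by
  have := tr (α := Fin D.nc) ((D.pathFm f (k + 1) fun j => vr j).imp
    (Term.equal (rTm (fun j => vr j) (numTm L D.nb D.nc D.n k)) (numTm L D.nb D.nc D.n (f k))))
    (fun t y => by
      simp only [Formula.realize_imp, realize_pathFm, Formula.realize_equal, realize_rTm,
        realize_numTm, Term.realize_var, nodeOf_eq, rOf_eq]
      intro h
      simp only [numOf_eq, D.toNat_num]
      exact congrArg D.num (D.path_eq f k y fun i hi => h i (Nat.lt_succ_of_le hi))) e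
  simp only [Formula.realize_imp, realize_pathFm, Formula.realize_equal, realize_rTm,
    realize_numTm, Term.realize_var] at this
  exact this fun i hi => h i (Nat.le_of_lt_succ hi)

theorem exists_branch (tr : D.Transfers M) (k : ℕ) (y : ℕ → M) : ∃ x : Fin D.n → M, ∀ i < k,
    (D.σ i).formula.Realize (Sum.elim x fun j => fOf L D.nb D.nc D.n i (fun l => y l) j) := by
  have := tr (α := ℕ) (Formula.iExs (Fin D.n) (Formula.iInf fun i : Fin k =>
    (D.σ i).formula.atPair (fun j => vr (.inr j))
      fun j => fTm (nb := D.nb) (nc := D.nc) (n := D.n) i (fun l => vr (.inl (l : ℕ))) j))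
    (fun t y => by
      simp only [Formula.realize_iExs, Formula.realize_iInf, Formula.realize_atPair, realize_fTm,
        Term.realize_var, Sum.elim_inl, Sum.elim_inr, fOf_eq]
      obtain ⟨x, hx⟩ := D.exists_branch k y
      exact ⟨x, fun i => hx i i.2⟩) y
  simp only [Formula.realize_iExs, Formula.realize_iInf, Formula.realize_atPair, realize_fTm,
    Term.realize_var, Sum.elim_inl, Sum.elim_inr] at this
  obtain ⟨x, hx⟩ := this
  exact ⟨x, fun i hi => hx ⟨i, hi⟩⟩

/-- The bound `(D.σ i).k` is a fixed natural number, so a finite disjunction expresses that the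
index is standard. A quantifier over numbers would allow nonstandard indices after transfer. -/
theorem exists_eq_gOf (tr : D.Transfers M) (i : ℕ) (x : Fin D.n → M) (y : ℕ → M)
    (h : (D.σ i).formula.Realize (Sum.elim x fun j => fOf L D.nb D.nc D.n i (fun l => y l) j)) :
    ∃ j, y i = gOf L D.nb D.nc D.n i x (fun l => y l) (numOf L D.nb D.nc D.n j) := by
  have := tr (α := Fin D.n ⊕ ℕ) (((D.σ i).formula.atPair (fun j => vr (.inl j))
      fun j => fTm (nb := D.nb) (nc := D.nc) (n := D.n) i (fun l => vr (.inr (l : ℕ))) j).imp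
    (Formula.iSup fun j : Fin (D.σ i).k => Term.equal (vr (.inr i))
      (gTm i (fun l => vr (.inl l)) (fun l => vr (.inr (l : ℕ))) (numTm L D.nb D.nc D.n j))))
    (fun t y => by
      simp only [Formula.realize_imp, Formula.realize_iSup, Formula.realize_atPair, realize_fTm,
        Formula.realize_equal, realize_gTm, realize_numTm, Term.realize_var, fOf_eq, gOf_eq]
      intro h
      obtain ⟨j, hj, he⟩ := D.exists_eq_sibling i (fun l => y (.inl l)) (fun l => y (.inr l)) h
      refine ⟨⟨j, hj⟩, ?_⟩
      simp only [numOf_eq, D.toNat_num]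
      exact he) (Sum.elim x y)
  simp only [Formula.realize_imp, Formula.realize_iSup, Formula.realize_atPair, realize_fTm,
    Formula.realize_equal, realize_gTm, realize_numTm, Term.realize_var, Sum.elim_inl,
    Sum.elim_inr] at this
  obtain ⟨j, hj⟩ := this h
  exact ⟨j, hj⟩

/-- Failure of `θ` at a decoded value is itself a formula of the expanded language in the index,
with `a`, `x` and `e` as parameters, so `exists_least` applies. This is the source of overspill. -/
theorem least (tr : D.Transfers M) {k m : ℕ} (θ : L.Formula (Fin k ⊕ Fin m)) (a : Fin m → M)
    (x : Fin D.n → M) (e : Fin D.nc → M) (i i₀ : M) (hi : leOf L D.nb D.nc D.n i₀ i)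
    (h : ¬ θ.Realize (Sum.elim
      (fun j => projOf L D.nb D.nc D.n k j (decOf L D.nb D.nc D.n x e i)) a)) :
    ∃ h, leOf L D.nb D.nc D.n i₀ h ∧
      ¬ θ.Realize (Sum.elim
        (fun j => projOf L D.nb D.nc D.n k j (decOf L D.nb D.nc D.n x e h)) a) ∧
      ∀ l, leOf L D.nb D.nc D.n i₀ l → leOf L D.nb D.nc D.n l h → l ≠ h →
        θ.Realize (Sum.elim
          (fun j => projOf L D.nb D.nc D.n k j (decOf L D.nb D.nc D.n x e l)) a) := by
  have hP : ∀ z : M, ((θ.atPair (fun j => projTm k j (decTm (fun l => vr (.inl (.inr (.inl l))))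
      (fun l => vr (.inl (.inr (.inr l)))) (vr (.inr ())))) (fun j => vr (.inl (.inl j)))).not :
      (L.withCoding D.nb D.nc D.n).Formula ((Fin m ⊕ Fin D.n ⊕ Fin D.nc) ⊕ Unit)).Realize
        (Sum.elim (Sum.elim a (Sum.elim x e)) fun _ => z) ↔
      ¬ θ.Realize (Sum.elim
        (fun j => projOf L D.nb D.nc D.n k j (decOf L D.nb D.nc D.n x e z)) a) := fun z => by
    simp only [Formula.realize_not, Formula.realize_atPair, realize_projTm, realize_decTm,
      Term.realize_var, Sum.elim_inl, Sum.elim_inr]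
  obtain ⟨j, hj, hj', hl⟩ := tr.exists_least _ _ _ i hi ((hP i).2 h)
  refine ⟨j, hj, (hP j).1 hj', fun l hl₀ hlj hne => ?_⟩
  have := hl l hl₀ hlj hne
  rwa [hP, not_not] at this

/-- A nonstandard structure to which coding models transfer has a coding expansion. -/
noncomputable def codingExpansion (tr : D.Transfers M)
    (hinf : ∀ k, (infOf L D.nb D.nc D.n : M) ≠ numOf L D.nb D.nc D.n k) :
    CodingExpansion L M where
  num := numOf L D.nb D.nc D.n
  le := leOf L D.nb D.nc D.n
  inf := infOf L D.nb D.nc D.n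
  nb := D.nb
  nc := D.nc
  φ := D.φ
  B := bOf L D.nb D.nc D.n
  node := nodeOf L D.nb D.nc D.n
  n := D.n
  σ := D.σ
  F := fOf L D.nb D.nc D.n
  G := gOf L D.nb D.nc D.n
  R := rOf L D.nb D.nc D.n
  dec := decOf L D.nb D.nc D.n
  proj := projOf L D.nb D.nc D.n
  num_injective := tr.num_injective
  le_num_iff := tr.le_num_iff
  le_left := tr.le_left
  le_right := tr.le_right
  le_total := tr.le_total
  le_antisymm := tr.le_antisymm
  le_trans := tr.le_trans
  le_inf := tr.le_inf
  inf_ne := hinf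
  exists_pred := tr.exists_pred
  order := tr.order
  order_least := tr.order_least
  exists_path := tr.exists_path
  R_eq := tr.rOf_numOf
  exists_branch := tr.exists_branch
  exists_eq_G := tr.exists_eq_gOf
  dec_num := tr.decOf_numOf
  exists_proj := tr.exists_projOf
  least := tr.least

end Transfers

end CodingModel

/-! ### The limit of the standard expansions and its theory -/

namespace CodingModel

variable {L : Language.{u, v}} {M₀ : Type u'} [L.Structure M₀] [Nonempty M₀] (D : CodingModel L M₀)

/-- The ultraproduct of the expansions of a coding model. -/
def Limit (D : CodingModel L M₀) : Type u' :=
  (Filter.hyperfilter ℕ : Filter ℕ).Product D.Expanded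

noncomputable instance : (L.withCoding D.nb D.nc D.n).Structure D.Limit :=
  Ultraproduct.structure

instance : Nonempty D.Limit := inferInstanceAs (Nonempty (Filter.Product _ D.Expanded))

theorem limit_models_of_eventually (ψ : (L.withCoding D.nb D.nc D.n).Sentence)
    (h : ∀ᶠ t in (Filter.hyperfilter ℕ : Filter ℕ), D.Expanded t ⊨ ψ) : D.Limit ⊨ ψ :=
  (Ultraproduct.sentence_realize ψ).2 h

/-- The complete theory of the limit of the expansions of a coding model. -/
def limitTheory : (L.withCoding D.nb D.nc D.n).Theory :=
  (L.withCoding D.nb D.nc D.n).completeTheory D.Limit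

/-- A formula valid in every standard expansion has a universal closure true in every factor of the
ultraproduct, hence belonging to `limitTheory`. -/
theorem transfers_of_models (M : Type v') [(L.withCoding D.nb D.nc D.n).Structure M] [Nonempty M]
    [M ⊨ D.limitTheory] : D.Transfers M := by
  intro α ψ h
  refine (Formula.realize_universalClosure ψ).1 (Theory.realize_sentence_of_mem D.limitTheory ?_)
  exact D.limit_models_of_eventually _ (Filter.Eventually.of_forall fun t =>
    (Formula.realize_universalClosure ψ).2 (h t))

/-- In the factor with index `t`, `inf` is the numeral `t`, which differs from the numeral `k` as
soon as `t > k`. -/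
theorem infOf_ne_numOf_of_models (M : Type v') [(L.withCoding D.nb D.nc D.n).Structure M]
    [M ⊨ D.limitTheory] (k : ℕ) :
    (infOf L D.nb D.nc D.n : M) ≠ numOf L D.nb D.nc D.n k := by
  have hiff : ∀ {N : Type _} [(L.withCoding D.nb D.nc D.n).Structure N],
      N ⊨ ((Term.equal (infTm L D.nb D.nc D.n) (numTm L D.nb D.nc D.n k)).not :
        (L.withCoding D.nb D.nc D.n).Sentence) ↔
      (infOf L D.nb D.nc D.n : N) ≠ numOf L D.nb D.nc D.n k := by
    intro N _
    rw [Sentence.Realize, Formula.realize_not, Formula.realize_equal, realize_infTm,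
      realize_numTm]
  have hmem : ((Term.equal (infTm L D.nb D.nc D.n) (numTm L D.nb D.nc D.n k)).not :
      (L.withCoding D.nb D.nc D.n).Sentence) ∈ D.limitTheory := by
    refine D.limit_models_of_eventually _ ?_
    filter_upwards [Nat.hyperfilter_le_atTop (Filter.eventually_gt_atTop k)] with t ht
    rw [Sentence.Realize, Formula.realize_not, Formula.realize_equal, realize_infTm,
      realize_numTm, infOf_eq, numOf_eq]
    exact fun h => ht.ne' (D.num_injective h)
  exact hiff.1 (Theory.realize_sentence_of_mem D.limitTheory hmem)

theorem onTheory_subset_limitTheory (T : L.Theory) [h : M₀ ⊨ T] :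
    (LHom.sumInl : L →ᴸ L.withCoding D.nb D.nc D.n).onTheory T ⊆ D.limitTheory := by
  rintro _ ⟨ψ, hψ, rfl⟩
  refine D.limit_models_of_eventually _ (Filter.Eventually.of_forall fun t => ?_)
  rw [LHom.realize_onSentence]
  exact h.realize_of_mem ψ hψ

end CodingModel

theorem max_aleph0_card_withFunctions (L : Language.{u, v}) {S : Type} [Countable S]
    (ar : S → Type) [∀ s, Fintype (ar s)] : max ℵ₀ (L.withFunctions ar).card = max ℵ₀ L.card := by
  rw [card_sum, lift_id, lift_id]
  apply le_antisymm
  · refine max_le (le_max_left _ _) ((add_le_add le_rfl card_functionLanguage_le).trans ?_)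
    refine add_le_of_le (le_max_left _ _) (le_max_right _ _) (le_max_left _ _)
  · exact max_le_max le_rfl (self_le_add_right _ _)

end FirstOrder.Language

/-! ### The main theorem -/

theorem mainTheorem4 {L : FirstOrder.Language.{u, v}} (T : L.Theory) (hT : T.IsComplete)
    (hunstable : ¬ T.IsStable) (hnss : ¬ T.IsSupersimple)
    (κ : Cardinal.{w}) (hκ : κ.IsSingular) (hcof : κ.ord.cof = Cardinal.aleph0)
    (hTκ : Cardinal.lift.{w} T.size ≤ Cardinal.lift.{max u v} κ) :
    ∃ (L₁ : FirstOrder.Language.{u, v}) (ι : FirstOrder.Language.LHom L L₁) (T₁ : L₁.Theory),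
      ι.Injective ∧ ι.onTheory T ⊆ T₁ ∧ T₁.IsComplete ∧ T₁.size = T.size ∧
      ∀ M : T₁.ModelType.{u, v, w},
        @FirstOrder.Language.IsSaturated L κ M (ι.reduct M) →
          @FirstOrder.Language.IsSaturated L (Order.succ κ) M (ι.reduct M) := by
  open FirstOrder.Language in
  obtain ⟨M₀, _, _, hM₀, ⟨n, σ, F, hF⟩, nb, nc, φ, b, c, hφ⟩ :=
    exists_coding_model T hT hunstable hnss
  obtain ⟨D⟩ := CodingModel.exists_of_ordersBy hF hφ
  refine ⟨L.withCoding D.nb D.nc D.n, LHom.sumInl, D.limitTheory, LHom.sumInl_injective,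
    D.onTheory_subset_limitTheory T, completeTheory.isComplete _ _,
    max_aleph0_card_withFunctions L _, fun M hM => ?_⟩
  let _ := (LHom.sumInl : L →ᴸ L.withCoding D.nb D.nc D.n).reduct M
  have := LHom.isExpansionOn_reduct (LHom.sumInl : L →ᴸ L.withCoding D.nb D.nc D.n) M
  have tr : D.Transfers M := D.transfers_of_models M
  -- Singularity enters only here: it makes κ uncountable, so that countable families of conditions
  -- are realized.
  have hlt : Cardinal.aleph0 < κ := hcof ▸ hκ.cof_ord_lt
  exact (tr.codingExpansion (D.infOf_ne_numOf_of_models M)).isSaturated_succ hlt hcof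
    ((Cardinal.lift_le.2 (le_max_right _ _)).trans hTκ) hM
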